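/- Let $j\ge 1$ be an integer and $\mathbb T=\mathbb R/2\pi\mathbb Z$. For $s,b\in\mathbb R$ let $X^{s,b}$ be the space of (complex-valued) distributions $g$ on $\mathbb R\times\mathbb T$ whose space-time Fourier transform $\widetilde g$ (where $\widetilde g(\tau,k)=\frac1{2\pi}\int_{\mathbb R}\int_{\mathbb T}e^{-it\tau}e^{-ikx}g(t,x)\,dx\,dt$ for Schwartz $g$) is a measurable function with $$\|g\|_{X^{s,b}}^2=\frac1{2\pi}\sum_{k\in\mathbb Z}\int_{\mathbb R}\langle k\rangle^{2s}\langle\tau-k^{2j+1}\rangle^{2b}\,|\widetilde g(\tau,k)|^2\,d\tau<\infty,\qquad \langle r\rangle=(1+r^2)^{1/2};$$ equivalently, $X^{s,b}$ is the closure of the Schwartz functions under this norm. For $T>0$ let $X_T^{s,b}$ be the space of restrictions to $(0,T)\times\mathbb T$ of elements of $X^{s,b}$, with norm $\|f\|_{X_T^{s,b}}=\inf\{\|g\|_{X^{s,b}} : g=f\text{ on }(0,T)\times\mathbb T\}$ (equal to $+\infty$ for a distribution $f$ that is not in $X_T^{s,b}$). **Proposition 4.5 (propagation of compactness).** Let $T>0$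 and $0\le b'\le b\le 1$ with $b>0$. Suppose that $u_n\in X_T^{0,b}$ and $f_n\in X_T^{-2j+2jb,-b}$ satisfy $$\partial_t u_n+(-1)^{j+1}\partial_x^{2j+1}u_n=f_n$$ in the sense of distributions on $(0,T)\times\mathbb T$, for every $n\in\mathbb N$. Assume that there is a constant $C>0$ with $$\|u_n\|_{X_T^{0,b}}\le C\quad\text{for all }n,$$ and that $$\|u_n\|_{X_T^{-2j+2jb,-b}}+\|f_n\|_{X_T^{-2j+2jb,-b}}+\|u_n\|_{X_T^{-1+2jb',-b'}}\to 0\quad\text{as }n\to\infty.$$ Assume in addition that for some nonempty open set $\omega\subset\mathbb T$, $$u_n\to 0\quad\text{strongly in }L^2(0,T;L^2(\omega)).$$ Then $$u_n\to 0\quad\text{strongly in }L^2_{loc}((0,T);L^2(\mathbb T)),$$ that is, $u_n\to0$ in $L^2(I;L^2(\mathbb T))$ for every compact interval $I\subset(0,T)$. -/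

import Mathlib

open MeasureTheory Filter Topology Set
open scoped ENNReal NNReal

noncomputable section

namespace Kdv

instance factTwoPiPos : Fact (0 < 2 * Real.pi) := ⟨Real.two_pi_pos⟩

/-- The torus `𝕋 = ℝ / 2πℤ`; its volume is Lebesgue measure, of total mass `2π`. -/
abbrev Torus : Type := AddCircle (2 * Real.pi)

/-- Space-time `ℝ × 𝕋`, with points `(t, x)` and the product measure `dt dx`. -/
abbrev SpaceTime : Type := ℝ × Torus

/-- A function on `ℝ × 𝕋`, read as a function on `ℝ × ℝ` that is `2π`-periodic in the second
variable. -/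
def lift (φ : SpaceTime → ℂ) : ℝ × ℝ → ℂ := fun p => φ (p.1, (p.2 : Torus))

/-! ### Test functions and distributions on subsets of `ℝ × 𝕋` -/

/-- The space `C_c^∞(U)` of complex smooth functions on `ℝ × 𝕋` with compact support in `U`. -/
def TestFunctions (U : Set SpaceTime) : Submodule ℂ (SpaceTime → ℂ) where
  carrier := {φ | ContDiff ℝ (⊤ : ℕ∞) (lift φ) ∧ HasCompactSupport φ ∧ tsupport φ ⊆ U}
  zero_mem' := by
    refine ⟨contDiff_const (c := (0 : ℂ)), HasCompactSupport.zero, ?_⟩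
    simp [tsupport]
  add_mem' := by
    rintro φ ψ ⟨h1, h2, h3⟩ ⟨k1, k2, k3⟩
    exact ⟨h1.add k1, h2.add k2, (tsupport_add φ ψ).trans (union_subset h3 k3)⟩
  smul_mem' := by
    rintro c φ ⟨h1, h2, h3⟩
    refine ⟨contDiff_const.smul h1, h2.mono' ?_, ?_⟩
    · exact (Function.support_const_smul_subset c φ).trans (subset_tsupport φ)
    · exact (closure_mono (Function.support_const_smul_subset c φ)).trans h3

/-- Extension by zero of test functions from `U` to a larger set `V`. -/
def TestFunctions.extend {U V : Set SpaceTime} (h : U ⊆ V) :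
    TestFunctions U →ₗ[ℂ] TestFunctions V :=
  Submodule.inclusion fun _ hφ => ⟨hφ.1, hφ.2.1, hφ.2.2.trans h⟩

/-- The time derivative of a function on `ℝ × 𝕋`. -/
def timeDeriv (φ : SpaceTime → ℂ) : SpaceTime → ℂ :=
  fun p => deriv (fun h : ℝ => φ (p.1 + h, p.2)) 0

/-- The space derivative of a function on `ℝ × 𝕋`. -/
def spaceDeriv (φ : SpaceTime → ℂ) : SpaceTime → ℂ :=
  fun p => deriv (fun h : ℝ => φ (p.1, p.2 + (h : Torus))) 0

theorem lift_timeDeriv {φ : SpaceTime → ℂ} (h : ContDiff ℝ (⊤ : ℕ∞) (lift φ)) :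
    lift (timeDeriv φ) = fun p => fderiv ℝ (lift φ) p (1, 0) := by
  funext p
  have hd : HasFDerivAt (lift φ) (fderiv ℝ (lift φ) p) (p + (0 : ℝ) • ((1 : ℝ), (0 : ℝ))) := by
    simpa using (h.differentiable (by simp) p).hasFDerivAt
  have hl : HasDerivAt (fun s : ℝ => p + s • ((1 : ℝ), (0 : ℝ))) ((1 : ℝ), (0 : ℝ)) 0 := by
    simpa using ((hasDerivAt_id (0 : ℝ)).smul_const ((1 : ℝ), (0 : ℝ))).const_add p
  have := (hd.comp_hasDerivAt (0 : ℝ) hl).deriv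
  simpa [lift, timeDeriv, Function.comp_def] using this

theorem lift_spaceDeriv {φ : SpaceTime → ℂ} (h : ContDiff ℝ (⊤ : ℕ∞) (lift φ)) :
    lift (spaceDeriv φ) = fun p => fderiv ℝ (lift φ) p (0, 1) := by
  funext p
  have hd : HasFDerivAt (lift φ) (fderiv ℝ (lift φ) p) (p + (0 : ℝ) • ((0 : ℝ), (1 : ℝ))) := by
    simpa using (h.differentiable (by simp) p).hasFDerivAt
  have hl : HasDerivAt (fun s : ℝ => p + s • ((0 : ℝ), (1 : ℝ))) ((0 : ℝ), (1 : ℝ)) 0 := by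
    simpa using ((hasDerivAt_id (0 : ℝ)).smul_const ((0 : ℝ), (1 : ℝ))).const_add p
  have := (hd.comp_hasDerivAt (0 : ℝ) hl).deriv
  simpa [lift, spaceDeriv, Function.comp_def] using this

theorem tsupport_timeDeriv (φ : SpaceTime → ℂ) : tsupport (timeDeriv φ) ⊆ tsupport φ := by
  refine closure_minimal (fun p hp => ?_) (isClosed_tsupport φ)
  by_contra hn
  refine hp ?_
  have h0 : φ =ᶠ[𝓝 p] 0 := notMem_tsupport_iff_eventuallyEq.mp hn
  have hc : Tendsto (fun h : ℝ => ((p.1 + h, p.2) : SpaceTime)) (𝓝 0) (𝓝 p) := by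
    have : Continuous (fun h : ℝ => ((p.1 + h, p.2) : SpaceTime)) := by fun_prop
    simpa using this.tendsto 0
  have h1 : (fun h : ℝ => φ (p.1 + h, p.2)) =ᶠ[𝓝 0] fun _ => (0 : ℂ) := hc.eventually h0
  simp [timeDeriv, h1.deriv_eq]

theorem tsupport_spaceDeriv (φ : SpaceTime → ℂ) : tsupport (spaceDeriv φ) ⊆ tsupport φ := by
  refine closure_minimal (fun p hp => ?_) (isClosed_tsupport φ)
  by_contra hn
  refine hp ?_
  have h0 : φ =ᶠ[𝓝 p] 0 := notMem_tsupport_iff_eventuallyEq.mp hn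
  have hc : Tendsto (fun h : ℝ => ((p.1, p.2 + (h : Torus)) : SpaceTime)) (𝓝 0) (𝓝 p) := by
    have : Continuous (fun h : ℝ => ((p.1, p.2 + (h : Torus)) : SpaceTime)) :=
      continuous_const.prodMk (continuous_const.add (AddCircle.continuous_mk' _))
    simpa using this.tendsto 0
  have h1 : (fun h : ℝ => φ (p.1, p.2 + (h : Torus))) =ᶠ[𝓝 0] fun _ => (0 : ℂ) :=
    hc.eventually h0
  simp [spaceDeriv, h1.deriv_eq]

/-- `∂_t` on test functions. -/
def TestFunctions.dt {U : Set SpaceTime} (φ : TestFunctions U) : TestFunctions U :=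
  ⟨timeDeriv φ.1, by
    obtain ⟨h1, h2, h3⟩ := φ.2
    refine ⟨?_, h2.mono' ((subset_tsupport _).trans (tsupport_timeDeriv _)),
      (tsupport_timeDeriv _).trans h3⟩
    rw [lift_timeDeriv h1]
    exact (h1.fderiv_right (m := ((⊤ : ℕ∞) : WithTop ℕ∞)) (by simp)).clm_apply contDiff_const⟩

/-- `∂_x` on test functions. -/
def TestFunctions.dx {U : Set SpaceTime} (φ : TestFunctions U) : TestFunctions U :=
  ⟨spaceDeriv φ.1, by
    obtain ⟨h1, h2, h3⟩ := φ.2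
    refine ⟨?_, h2.mono' ((subset_tsupport _).trans (tsupport_spaceDeriv _)),
      (tsupport_spaceDeriv _).trans h3⟩
    rw [lift_spaceDeriv h1]
    exact (h1.fderiv_right (m := ((⊤ : ℕ∞) : WithTop ℕ∞)) (by simp)).clm_apply contDiff_const⟩

/-- Distributions on `U` (meant for open `U`): linear forms on `C_c^∞(U)` which, on the test
functions supported in a given compact subset of `U`, are controlled by finitely many derivatives.
A function `g` acts by `φ ↦ ∫ g φ dt dx` (no complex conjugation). -/
structure Distr (U : Set SpaceTime) where
  toLin : TestFunctions U →ₗ[ℂ] ℂ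
  bound : ∀ K : Set SpaceTime, IsCompact K → K ⊆ U → ∃ (N : ℕ) (C : ℝ),
    ∀ φ : TestFunctions U, tsupport φ.1 ⊆ K → ∀ B : ℝ,
      (∀ i ≤ N, ∀ p : ℝ × ℝ, ‖iteratedFDeriv ℝ i (lift φ.1) p‖ ≤ B) → ‖toLin φ‖ ≤ C * B

/-- The distributions `g` on `V` and `f` on the smaller set `U` coincide on `U`. -/
def Distr.EqOn {U V : Set SpaceTime} (h : U ⊆ V) (g : Distr V) (f : Distr U) : Prop :=
  ∀ φ : TestFunctions U, g.toLin (TestFunctions.extend h φ) = f.toLin φ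

/-- `∂_t u + (-1)^{j+1} ∂_x^{2j+1} u = f` in the sense of distributions on `U`. Integration by
parts produces the factors `-1` and `(-1)^{2j+1}`. -/
def SolvesLinear (j : ℕ) {U : Set SpaceTime} (u f : Distr U) : Prop :=
  ∀ φ : TestFunctions U,
    -u.toLin (TestFunctions.dt φ)
      + (-1 : ℂ) ^ (j + 1) * ((-1 : ℂ) ^ (2 * j + 1) * u.toLin (TestFunctions.dx^[2 * j + 1] φ))
      = f.toLin φ

/-! ### Bourgain spaces -/

/-- The bracket `⟨r⟩ = (1 + r²)^{1/2}`. -/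
def bracket (r : ℝ) : ℝ := Real.sqrt (1 + r ^ 2)

/-- The space-time Fourier transform
`φ̃(τ, k) = (2π)⁻¹ ∫_ℝ ∫_𝕋 e^{-itτ} e^{-ikx} φ(t, x) dx dt`. Here `fourier (-k) x = e^{-ikx}`. -/
def fourierST (φ : SpaceTime → ℂ) (τ : ℝ) (k : ℤ) : ℂ :=
  (1 / (2 * Real.pi) : ℂ) *
    ∫ p : SpaceTime, Complex.exp (-(Complex.I * p.1 * τ)) * fourier (-k) p.2 * φ p

/-- The Fourier transform of the distribution `g` on `ℝ × 𝕋` is the family of functions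
`F k = g̃(·, k)`; that is, `g = (2π)⁻¹ ∑ₖ ∫ e^{itτ} e^{ikx} F k τ dτ`, tested against `φ`. -/
def HasFourier (g : Distr univ) (F : ℤ → ℝ → ℂ) : Prop :=
  ∀ φ : TestFunctions univ, g.toLin φ = ∑' k : ℤ, ∫ τ : ℝ, F k τ * fourierST φ.1 (-τ) (-k)

/-- `( (2π)⁻¹ ∑ₖ ∫ ⟨k⟩^{2s} ⟨τ - k^{2j+1}⟩^{2b} |F k τ|² dτ )^{1/2}`, with values in `[0, ∞]`. -/
def weightedNorm (j : ℕ) (s b : ℝ) (F : ℤ → ℝ → ℂ) : ℝ≥0∞ :=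
  (ENNReal.ofReal (1 / (2 * Real.pi)) * ∑' k : ℤ, ∫⁻ τ : ℝ,
    ENNReal.ofReal (bracket k ^ (2 * s) * bracket (τ - (k : ℝ) ^ (2 * j + 1)) ^ (2 * b))
      * ‖F k τ‖ₑ ^ 2) ^ (1 / 2 : ℝ)

/-- The norm of `X^{s,b}`. It is `∞` on the distributions that are not in `X^{s,b}`, i.e. whose
Fourier transform is not a measurable function in the weighted `L²` space. (There is at most one
such function up to null sets, so that the infimum only selects it.) -/
def xNorm (j : ℕ) (s b : ℝ) (g : Distr univ) : ℝ≥0∞ :=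
  ⨅ (F : ℤ → ℝ → ℂ) (_ : ∀ k, AEStronglyMeasurable (F k) volume) (_ : HasFourier g F),
    weightedNorm j s b F

/-- The space-time slab `(0,T) × 𝕋`. -/
def slab (T : ℝ) : Set SpaceTime := Ioo 0 T ×ˢ univ

/-- The norm of `X_T^{s,b}`: the infimum of the `X^{s,b}` norms of the extensions of `f` from
`(0,T) × 𝕋` to `ℝ × 𝕋`; it is `∞` if `f` is not in `X_T^{s,b}`. -/
def xTNorm (j : ℕ) (T s b : ℝ) (f : Distr (slab T)) : ℝ≥0∞ :=
  ⨅ (g : Distr univ) (_ : Distr.EqOn (subset_univ _) g f), xNorm j s b g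

/-- Membership in `X_T^{s,b}`. -/
def MemXT (j : ℕ) (T s b : ℝ) (f : Distr (slab T)) : Prop := xTNorm j T s b f < ∞

/-! ### `L²` norms of distributions -/

/-- The distribution `u` is given on `V` by the function `v`. -/
def Distr.IsFunctionOn {U : Set SpaceTime} (u : Distr U) (V : Set SpaceTime)
    (v : SpaceTime → ℂ) : Prop :=
  ∀ φ : TestFunctions U, tsupport φ.1 ⊆ V → u.toLin φ = ∫ p in V, v p * φ.1 p

/-- The norm in `L²(I; L²(ω))` of the restriction of `u` to the open set `I × ω`; it is `∞` if this
restriction is not a square-integrable function. -/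
def Distr.l2Norm {U : Set SpaceTime} (u : Distr U) (I : Set ℝ) (ω : Set Torus) : ℝ≥0∞ :=
  ⨅ (v : SpaceTime → ℂ) (_ : AEStronglyMeasurable v (volume.restrict (I ×ˢ ω)))
    (_ : u.IsFunctionOn (I ×ˢ ω) v), eLpNorm v 2 (volume.restrict (I ×ˢ ω))

end Kdv

end

/-!
Solutions are studied through the localized Fourier transforms
`Uₖ(σ) = u(φ(t) e^{-iσt} e^{-ikx})`, where `φ` is a test function on `(0, T)`. They depend only on
the distribution `u` on the slab, and any extension of `u` with Fourier transform `F` gives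
`Uₖ = Fₖ * φ̂` (`locFT_eq_integral`). Schur's test and Peetre's inequality then bound the weighted
norm of `U` by the norm of `u` in `X_T^{s,b}`, for all `s` and `|b| ≤ 1` (`weightedNorm_locFT_le`).

In these terms the equation is the pointwise identity `i (σ - k^{2j+1}) Uₖ = Gₖ`, where `G` collects
the contributions of `f` and of `φ'` (`locFT_of_solvesLinear`). For `l = k - m` with `m ≠ 0` it
gives `(k^{2j+1} - l^{2j+1}) Uₖ conj(Uₗ) = i (Gₖ conj(Uₗ) + Uₖ conj(Gₗ))`.
Odd powers are injective and `|k^{2j+1} - l^{2j+1}|` is at least of the order of `⟨l⟩^{2j}`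
(`one_add_sq_pow_le`), so that the resonance function can be divided out. What it gains is precisely
the gap between the weights of `X^{0,b}` and of the dual of `X^{-2j+2jb,-b}` (`one_le_weights`), and
the correlation `∑ₖ ∫ Uₖ conj(Uₖ₋ₘ) dσ` is bounded by `‖u‖_{0,b}` times the weak norms of `f` and
`u` (`tsum_lintegral_locFT_shift_le`). The argument deals with one Fourier mode at a time and needs
no pseudodifferential calculus.

Since `b ≥ 0`, each `u` is a square-integrable function (`exists_memLp_of_memXT`). By Plancherel's
identity on `ℝ × 𝕋` (`integral_inner_dualFT`) the correlation above is the integral of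
`e^{imx} |φ u|²`. Along the sequence these integrals thus tend to zero for all `m ≠ 0`, while the
masses of `|φ uₙ|²` stay bounded; as trigonometric polynomials are dense in `C(𝕋)`, the integral of
`h(x) |φ uₙ|²` is asymptotically the mean of `h` times the mass (`tendsto_sub_integral_mul`). Taking
`h = |ψ|²` with a cutoff `ψ` supported in `ω`, the left-hand side tends to zero by the assumption on
`ω` (`eLpNorm_cut_le_l2Norm`), and hence so does the mass.
-/

noncomputable section

namespace Kdv

open scoped FourierTransform ComplexConjugate

/-! ### Plancherel's identity on the line and on `ℝ × 𝕋` -/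

theorem eLpNorm_two_sq {α : Type*} [MeasurableSpace α] (μ : Measure α) (f : α → ℂ) :
    eLpNorm f 2 μ ^ 2 = ∫⁻ x, ‖f x‖ₑ ^ 2 ∂μ := by
  have h := eLpNorm_nnreal_pow_eq_lintegral (f := f) (μ := μ) (p := 2) (by norm_num)
  simpa only [NNReal.coe_ofNat, ENNReal.coe_ofNat, ENNReal.rpow_two] using h

/-- The `L²` Fourier transform of an integrable, square-integrable function is its Fourier
integral. -/
theorem coeFn_fourier_toLp {f : ℝ → ℂ} (h1 : Integrable f) (h2 : MemLp f 2) :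
    (𝓕 (h2.toLp f) : Lp ℂ 2 (volume : Measure ℝ)) =ᵐ[volume] 𝓕 f := by
  have hc : Continuous (𝓕 f) :=
    VectorFourier.fourierIntegral_continuous Real.continuous_fourierChar
      (by exact continuous_inner) h1
  -- Both sides agree as tempered distributions: test against a bump function `g` and move the
  -- Fourier transform onto it.
  refine ae_eq_of_integral_contDiff_smul_eq ?_ hc.locallyIntegrable ?_
  · exact ((Lp.memLp _).locallyIntegrable (by norm_num))
  intro g hg hgc
  have hg' : HasCompactSupport (fun x => (g x : ℂ)) := hgc.comp_left (g := Complex.ofReal) rfl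
  let G : SchwartzMap ℝ ℂ := hg'.toSchwartzMap (Complex.ofRealCLM.contDiff.comp hg)
  have hG : ∀ x, G x = g x := fun x => rfl
  have e1 := congrArg (fun D : TemperedDistribution ℝ ℂ => D G)
    (Lp.fourier_toTemperedDistribution_eq (h2.toLp f))
  simp only [TemperedDistribution.fourier_apply, Lp.toTemperedDistribution_apply, hG] at e1
  have e2 : ∫ x, g x • (𝓕 (h2.toLp f) : Lp ℂ 2 (volume : Measure ℝ)) x
      = ∫ x, (g x : ℂ) • (𝓕 (h2.toLp f) : Lp ℂ 2 (volume : Measure ℝ)) x := by simp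
  have e3 : ∫ x, g x • 𝓕 f x = ∫ x, (g x : ℂ) • 𝓕 f x := by simp
  rw [e2, e3, ← e1]
  have e4 := VectorFourier.integral_fourierIntegral_smul_eq_flip (μ := (volume : Measure ℝ))
    (ν := (volume : Measure ℝ)) (L := innerₗ ℝ) (f := fun x => G x) (g := f)
    Real.continuous_fourierChar (by exact continuous_inner) G.integrable h1
  rw [flip_innerₗ] at e4
  refine Eq.trans ?_ e4
  refine integral_congr_ae ?_
  filter_upwards [h2.coeFn_toLp] with x hx
  rw [hx]; rfl

/-- Plancherel's identity on `ℝ` for functions in `L¹ ∩ L²`. -/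
theorem lintegral_enorm_sq_fourier {f : ℝ → ℂ} (h1 : Integrable f) (h2 : MemLp f 2) :
    ∫⁻ x, ‖𝓕 f x‖ₑ ^ 2 = ∫⁻ x, ‖f x‖ₑ ^ 2 := by
  have key : eLpNorm (𝓕 f) 2 volume = eLpNorm f 2 volume := by
    rw [← eLpNorm_congr_ae (coeFn_fourier_toLp h1 h2), ← eLpNorm_congr_ae h2.coeFn_toLp]
    have := Lp.norm_fourier_eq (h2.toLp f)
    rw [Lp.norm_def, Lp.norm_def] at this
    exact (ENNReal.toReal_eq_toReal_iff' (Lp.eLpNorm_ne_top _) (Lp.eLpNorm_ne_top _)).1 this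
  rw [← eLpNorm_two_sq, ← eLpNorm_two_sq, key]

/-- Parseval's identity on `ℝ / 2πℤ`, for Lebesgue measure. -/
theorem tsum_enorm_sq_integral_fourier {h : Torus → ℂ} (hh : MemLp h 2) :
    ∑' k : ℤ, ‖∫ x, fourier (-k) x * h x‖ₑ ^ 2
      = ENNReal.ofReal (2 * Real.pi) * ∫⁻ x, ‖h x‖ₑ ^ 2 := by
  have hh' : MemLp h 2 AddCircle.haarAddCircle := memLp_haarAddCircle_iff.2 hh
  have hs := hasSum_sq_fourierCoeff (hh'.toLp h)
  have hcoef : ∀ k, fourierCoeff (hh'.toLp h : Torus → ℂ) k = fourierCoeff h k := fun k => by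
    rw [fourierCoeff_congr_ae hh'.coeFn_toLp]
  have hint : ∫ t, ‖(hh'.toLp h : Torus → ℂ) t‖ ^ 2 ∂AddCircle.haarAddCircle
      = ∫ t, ‖h t‖ ^ 2 ∂AddCircle.haarAddCircle :=
    integral_congr_ae (hh'.coeFn_toLp.mono fun x hx => by simp only [hx])
  simp only [hcoef] at hs
  rw [hint] at hs
  have h1 := ENNReal.ofReal_tsum_of_nonneg (fun k => sq_nonneg ‖fourierCoeff h k‖) hs.summable
  rw [hs.tsum_eq, ofReal_integral_eq_lintegral_ofReal (hh'.integrable_norm_pow (by norm_num))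
    (Eventually.of_forall fun x => by positivity)] at h1
  have hsq : ∀ z : ℂ, ENNReal.ofReal (‖z‖ ^ 2) = ‖z‖ₑ ^ 2 := fun z => by
    rw [ENNReal.ofReal_pow (norm_nonneg z), ofReal_norm]
  simp only [hsq] at h1
  have hpi : (0 : ℝ) < 2 * Real.pi := Real.two_pi_pos
  have hcv : ∀ k : ℤ, ‖∫ x, fourier (-k) x * h x‖ₑ ^ 2
      = ENNReal.ofReal (2 * Real.pi) ^ 2 * ‖fourierCoeff h k‖ₑ ^ 2 := fun k => by
    have : ∫ x, fourier (-k) x * h x = ((2 * Real.pi : ℝ) : ℂ) * fourierCoeff h k := by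
      rw [fourierCoeff, AddCircle.integral_haarAddCircle]
      simp only [smul_eq_mul, Complex.real_smul]
      rw [← mul_assoc, ← Complex.ofReal_mul, mul_inv_cancel₀ hpi.ne']; simp
    rw [this, enorm_mul, mul_pow, ← ofReal_norm (((2 * Real.pi : ℝ) : ℂ)), Complex.norm_real,
      Real.norm_of_nonneg hpi.le]
  simp only [hcv]
  rw [ENNReal.tsum_mul_left, ← h1, AddCircle.volume_eq_smul_haarAddCircle,
    lintegral_smul_measure, smul_eq_mul, sq, mul_assoc]

theorem integrable_fourierST_integrand {g : SpaceTime → ℂ} (hg : Integrable g) (τ : ℝ) (k : ℤ) :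
    Integrable (fun p : SpaceTime =>
      Complex.exp (-(Complex.I * p.1 * τ)) * fourier (-k) p.2 * g p) := by
  refine hg.bdd_mul (c := 1) ?_ ?_
  · exact Continuous.aestronglyMeasurable (by fun_prop)
  · refine Eventually.of_forall fun p => ?_
    rw [norm_mul, fourier_apply, Circle.norm_coe, Complex.norm_exp]
    simp

theorem fourierST_eq_fourier {g : SpaceTime → ℂ} (hg : Integrable g) (τ : ℝ) (k : ℤ) :
    fourierST g τ k = (1 / (2 * Real.pi) : ℂ) *
      𝓕 (fun t : ℝ => ∫ x, fourier (-k) x * g (t, x)) ((2 * Real.pi)⁻¹ * τ) := by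
  have hi := integrable_fourierST_integrand hg τ k
  rw [fourierST, Measure.volume_eq_prod, integral_prod _ hi, Real.fourier_real_eq_integral_exp_smul]
  congr 1
  refine integral_congr_ae (Eventually.of_forall fun t => ?_)
  simp only [smul_eq_mul, mul_assoc]
  rw [integral_const_mul]
  congr 2
  push_cast
  have : (Real.pi : ℂ) ≠ 0 := by exact_mod_cast Real.pi_ne_zero
  field_simp

theorem integrable_fourier_mul {g : SpaceTime → ℂ} (hg : Integrable g) (k : ℤ) :
    Integrable fun p : SpaceTime => fourier k p.2 * g p := by
  refine hg.bdd_mul (c := 1) (Continuous.aestronglyMeasurable (by fun_prop)) ?_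
  refine Eventually.of_forall fun p => ?_
  rw [fourier_apply, Circle.norm_coe]

theorem integrable_integral_fourier_mul {g : SpaceTime → ℂ} (hg : Integrable g) (k : ℤ) :
    Integrable fun t : ℝ => ∫ x, fourier k x * g (t, x) :=
  (integrable_fourier_mul hg k).integral_prod_left

theorem continuous_fourierST {g : SpaceTime → ℂ} (hg : Integrable g) (k : ℤ) :
    Continuous fun τ => fourierST g τ k := by
  simp only [fourierST_eq_fourier hg]
  have hc := VectorFourier.fourierIntegral_continuous Real.continuous_fourierChar
      (L := innerₗ ℝ) (by exact continuous_inner) (integrable_integral_fourier_mul hg (-k))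
  exact continuous_const.mul (hc.comp (continuous_const.mul continuous_id))

theorem lintegral_comp_inv_mul {a : ℝ} (ha : 0 < a) {f : ℝ → ℝ≥0∞} (hf : Measurable f) :
    ∫⁻ x, f (a⁻¹ * x) = ENNReal.ofReal a * ∫⁻ x, f x := by
  have h := Real.smul_map_volume_mul_left (inv_ne_zero ha.ne')
  conv_rhs => rw [← h]
  rw [lintegral_smul_measure, lintegral_map hf (by fun_prop), abs_of_pos (inv_pos.2 ha),
    smul_eq_mul, ← mul_assoc, ← ENNReal.ofReal_mul ha.le, mul_inv_cancel₀ ha.ne',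
    ENNReal.ofReal_one, one_mul]

/-- Plancherel's identity on `ℝ × 𝕋`, as an iterated sum: Plancherel on `ℝ` for each Fourier
coefficient in `x`, then Parseval on `𝕋` for almost every `t`. -/
theorem tsum_lintegral_fourierST {g : SpaceTime → ℂ} (h1 : Integrable g) (h2 : MemLp g 2) :
    ∑' k : ℤ, ∫⁻ τ, ‖fourierST g τ k‖ₑ ^ 2 = ∫⁻ p, ‖g p‖ₑ ^ 2 := by
  set c : ℤ → ℝ → ℂ := fun k t => ∫ x, fourier (-k) x * g (t, x) with hc
  have hpi : (0 : ℝ) < 2 * Real.pi := Real.two_pi_pos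
  have hfin : ∫⁻ p, ‖g p‖ₑ ^ 2 ≠ ∞ := by
    rw [← eLpNorm_two_sq]; exact ENNReal.pow_ne_top h2.2.ne
  have hm : AEMeasurable (fun p => ‖g p‖ₑ ^ 2) (volume.prod volume : Measure SpaceTime) :=
    h2.1.enorm.pow_const 2
  have hfub : ∫⁻ p, ‖g p‖ₑ ^ 2 = ∫⁻ t : ℝ, ∫⁻ x : Torus, ‖g (t, x)‖ₑ ^ 2 :=
    lintegral_prod _ hm
  have hsl : ∀ᵐ t : ℝ, MemLp (fun x => g (t, x)) 2 volume := by
    have a1 : ∀ᵐ t : ℝ, AEStronglyMeasurable (fun x => g (t, x)) volume := h2.1.prodMk_left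
    have a2 : ∀ᵐ t : ℝ, ∫⁻ x : Torus, ‖g (t, x)‖ₑ ^ 2 < ∞ :=
      ae_lt_top' hm.lintegral_prod_right' (hfub ▸ hfin)
    filter_upwards [a1, a2] with t b1 b2
    refine ⟨b1, ?_⟩
    rw [← eLpNorm_two_sq] at b2
    exact (ENNReal.pow_lt_top_iff.1 b2).resolve_right (by norm_num)
  have hpar : ∀ᵐ t : ℝ, ∑' k, ‖c k t‖ₑ ^ 2
      = ENNReal.ofReal (2 * Real.pi) * ∫⁻ x : Torus, ‖g (t, x)‖ₑ ^ 2 :=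
    hsl.mono fun t ht => tsum_enorm_sq_integral_fourier ht
  have hcint : ∀ k, Integrable (c k) := fun k => integrable_integral_fourier_mul h1 (-k)
  have hsum : ∑' k, ∫⁻ t, ‖c k t‖ₑ ^ 2 = ENNReal.ofReal (2 * Real.pi) * ∫⁻ p, ‖g p‖ₑ ^ 2 := by
    rw [← lintegral_tsum fun k => ((hcint k).1.enorm.pow_const 2), lintegral_congr_ae hpar,
      lintegral_const_mul' _ _ ENNReal.ofReal_ne_top, hfub]
  have hcL2 : ∀ k, MemLp (c k) 2 := fun k => by
    refine ⟨(hcint k).1, ?_⟩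
    have : ∫⁻ t, ‖c k t‖ₑ ^ 2 < ∞ := lt_of_le_of_lt
      ((ENNReal.le_tsum k).trans hsum.le) (ENNReal.mul_lt_top ENNReal.ofReal_lt_top hfin.lt_top)
    rw [← eLpNorm_two_sq] at this
    exact (ENNReal.pow_lt_top_iff.1 this).resolve_right (by norm_num)
  have hk : ∀ k, ∫⁻ τ, ‖fourierST g τ k‖ₑ ^ 2
      = (ENNReal.ofReal (2 * Real.pi))⁻¹ * ∫⁻ t, ‖c k t‖ₑ ^ 2 := fun k => by
    have hcont : Continuous (𝓕 (c k)) := VectorFourier.fourierIntegral_continuous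
      Real.continuous_fourierChar (L := innerₗ ℝ) (by exact continuous_inner) (hcint k)
    have he : ‖(1 / (2 * Real.pi) : ℂ)‖ₑ = (ENNReal.ofReal (2 * Real.pi))⁻¹ := by
      have : (1 / (2 * Real.pi) : ℂ) = (((2 * Real.pi)⁻¹ : ℝ) : ℂ) := by push_cast; simp
      rw [this, ← ofReal_norm, Complex.norm_real, Real.norm_of_nonneg (by positivity),
        ENNReal.ofReal_inv_of_pos hpi]
    simp only [fourierST_eq_fourier h1, enorm_mul, mul_pow]
    rw [lintegral_const_mul' _ _ (ENNReal.pow_ne_top enorm_ne_top),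
      lintegral_comp_inv_mul hpi (f := fun x => ‖𝓕 (c k) x‖ₑ ^ 2)
        (by fun_prop), lintegral_enorm_sq_fourier (hcint k) (hcL2 k), he, sq, mul_assoc,
      ← mul_assoc _ (ENNReal.ofReal (2 * Real.pi)), ENNReal.inv_mul_cancel
        (by simpa using Real.pi_pos) ENNReal.ofReal_ne_top, one_mul]
  simp only [hk]
  rw [ENNReal.tsum_mul_left, hsum, ← mul_assoc, ENNReal.inv_mul_cancel
        (by simpa using Real.pi_pos) ENNReal.ofReal_ne_top, one_mul]

/-- The measure on the dual group `ℤ × ℝ` of `𝕋 × ℝ`: counting measure times Lebesgue measure. -/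
abbrev dualMeasure : Measure (ℤ × ℝ) := (Measure.count : Measure ℤ).prod volume

theorem lintegral_dualMeasure {f : ℤ × ℝ → ℝ≥0∞} (hf : Measurable f) :
    ∫⁻ p, f p ∂dualMeasure = ∑' k, ∫⁻ τ, f (k, τ) := by
  rw [lintegral_prod _ hf.aemeasurable, lintegral_count]

/-- `fourierST g` as a function on the dual group `ℤ × ℝ`. -/
def dualFT (g : SpaceTime → ℂ) : ℤ × ℝ → ℂ := fun p => fourierST g p.2 p.1

theorem measurable_dualFT {g : SpaceTime → ℂ} (hg : Integrable g) : Measurable (dualFT g) :=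
  measurable_from_prod_countable_right fun k => (continuous_fourierST hg k).measurable

/-- Plancherel's identity on `ℝ × 𝕋`, in terms of `dualFT`. -/
theorem eLpNorm_dualFT {g : SpaceTime → ℂ} (h1 : Integrable g) (h2 : MemLp g 2) :
    eLpNorm (dualFT g) 2 dualMeasure = eLpNorm g 2 volume := by
  have h : eLpNorm (dualFT g) 2 dualMeasure ^ 2 = eLpNorm g 2 volume ^ 2 := by
    rw [eLpNorm_two_sq, eLpNorm_two_sq, ← tsum_lintegral_fourierST h1 h2,
      lintegral_dualMeasure ((measurable_dualFT h1).enorm.pow_const 2)]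
    rfl
  exact (ENNReal.pow_right_strictMono two_ne_zero).injective h

theorem memLp_dualFT {g : SpaceTime → ℂ} (h1 : Integrable g) (h2 : MemLp g 2) :
    MemLp (dualFT g) 2 dualMeasure :=
  ⟨(measurable_dualFT h1).aestronglyMeasurable, (eLpNorm_dualFT h1 h2).trans_lt h2.2⟩

theorem dualFT_add_smul {g h : SpaceTime → ℂ} (hg : Integrable g) (hh : Integrable h) (z : ℂ) :
    dualFT (g + z • h) = dualFT g + z • dualFT h := by
  funext p
  simp only [dualFT, fourierST, Pi.add_apply, Pi.smul_apply, smul_eq_mul, mul_add]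
  rw [integral_add (integrable_fourierST_integrand hg _ _)]
  · rw [mul_add]
    congr 1
    rw [mul_left_comm, ← integral_const_mul z]
    congr 2
    funext q
    ring
  · refine ((integrable_fourierST_integrand hh p.2 p.1).const_mul z).congr
      (Eventually.of_forall fun q => ?_)
    simp only; ring

/-- The polarized form of Plancherel's identity on `ℝ × 𝕋`. -/
theorem integral_inner_dualFT {g h : SpaceTime → ℂ} (g1 : Integrable g) (g2 : MemLp g 2)
    (h1 : Integrable h) (h2 : MemLp h 2) :
    ∫ p, dualFT h p * conj (dualFT g p) ∂dualMeasure = ∫ p, h p * conj (g p) := by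
  have key : ∀ z : ℂ, ‖(memLp_dualFT g1 g2).toLp _ + z • (memLp_dualFT h1 h2).toLp _‖
      = ‖g2.toLp _ + z • h2.toLp _‖ := fun z => by
    rw [← MemLp.toLp_const_smul, ← MemLp.toLp_add, ← MemLp.toLp_const_smul, ← MemLp.toLp_add,
      Lp.norm_toLp, Lp.norm_toLp, ← dualFT_add_smul g1 h1,
      eLpNorm_dualFT (g1.add (h1.smul z)) (g2.add (h2.const_smul z))]
  have e : inner ℂ ((memLp_dualFT g1 g2).toLp _) ((memLp_dualFT h1 h2).toLp _)
      = inner ℂ (g2.toLp _) (h2.toLp _) := by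
    have k1 := key 1
    have k2 := key (-1)
    have k3 := key (-Complex.I)
    have k4 := key Complex.I
    simp only [one_smul, neg_smul, ← sub_eq_add_neg] at k1 k2 k3 k4
    rw [inner_eq_sum_norm_sq_div_four, inner_eq_sum_norm_sq_div_four, k1, k2]
    simp only [RCLike.I_to_complex, k3, k4]
  rw [L2.inner_def, L2.inner_def] at e
  refine Eq.trans ?_ (e.trans ?_)
  · refine integral_congr_ae ?_
    filter_upwards [(memLp_dualFT g1 g2).coeFn_toLp, (memLp_dualFT h1 h2).coeFn_toLp] with p a b
    rw [a, b, RCLike.inner_apply]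
  · refine integral_congr_ae ?_
    filter_upwards [g2.coeFn_toLp, h2.coeFn_toLp] with p a b
    rw [a, b, RCLike.inner_apply]

theorem dualFT_fourier_mul (g : SpaceTime → ℂ) (m : ℤ) (p : ℤ × ℝ) :
    dualFT (fun q => fourier m q.2 * g q) p = dualFT g (p.1 - m, p.2) := by
  simp only [dualFT, fourierST]
  congr 2
  funext q
  rw [neg_sub, sub_eq_add_neg, fourier_add]
  ring

/-! ### Distributions with square-integrable Fourier transform -/

/-- The Cauchy–Schwarz inequality for `∑ₖ ∫ dτ`. -/
theorem tsum_lintegral_mul_le {f g : ℤ → ℝ → ℝ≥0∞} (hf : ∀ k, AEMeasurable (f k))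
    (hg : ∀ k, AEMeasurable (g k)) :
    ∑' k, ∫⁻ τ, f k τ * g k τ
      ≤ (∑' k, ∫⁻ τ, f k τ ^ 2) ^ (1 / 2 : ℝ) * (∑' k, ∫⁻ τ, g k τ ^ 2) ^ (1 / 2 : ℝ) := by
  have h1 : ∀ k, ∫⁻ τ, f k τ * g k τ
      ≤ (∫⁻ τ, f k τ ^ 2) ^ (1 / 2 : ℝ) * (∫⁻ τ, g k τ ^ 2) ^ (1 / 2 : ℝ) := fun k => by
    simpa using ENNReal.lintegral_mul_le_Lp_mul_Lq volume
      (Real.HolderConjugate.two_two) (hf k) (hg k)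
  refine (ENNReal.tsum_le_tsum h1).trans ?_
  have h2 := ENNReal.lintegral_mul_le_Lp_mul_Lq (Measure.count : Measure ℤ)
      (Real.HolderConjugate.two_two)
      (f := fun k => (∫⁻ τ, f k τ ^ 2) ^ (1 / 2 : ℝ))
      (g := fun k => (∫⁻ τ, g k τ ^ 2) ^ (1 / 2 : ℝ))
      (measurable_of_countable _).aemeasurable (measurable_of_countable _).aemeasurable
  simp only [lintegral_count, Pi.mul_apply, ← ENNReal.rpow_mul] at h2
  simpa using h2

theorem continuous_testFunction {U : Set SpaceTime} (θ : TestFunctions U) : Continuous θ.1 := by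
  have hq : IsOpenQuotientMap (Prod.map id ((↑) : ℝ → Torus) : ℝ × ℝ → SpaceTime) :=
    IsOpenQuotientMap.id.prodMap QuotientAddGroup.isOpenQuotientMap_mk
  exact hq.isQuotientMap.continuous_iff.2 θ.2.1.continuous

theorem integrable_testFunction {U : Set SpaceTime} (θ : TestFunctions U) : Integrable θ.1 :=
  (continuous_testFunction θ).integrable_of_hasCompactSupport θ.2.2.1

theorem memLp_testFunction {U : Set SpaceTime} (θ : TestFunctions U) (q : ℝ≥0∞) :
    MemLp θ.1 q :=
  (continuous_testFunction θ).memLp_of_hasCompactSupport θ.2.2.1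

/-- A linear form which is bounded in the seminorm `‖ι x‖` of a Hilbert space is represented by a
vector of that space. -/
theorem exists_inner_eq_of_norm_le {E H : Type*} [AddCommGroup E] [Module ℂ E]
    [NormedAddCommGroup H] [InnerProductSpace ℂ H] [CompleteSpace H] (ι : E →ₗ[ℂ] H)
    (l : E →ₗ[ℂ] ℂ) (A : ℝ) (hA : ∀ x, ‖l x‖ ≤ A * ‖ι x‖) :
    ∃ w : H, ∀ x, l x = inner ℂ w (ι x) := by
  have hl : l ∈ LinearMap.range ι.dualMap := by
    rw [LinearMap.range_dualMap_eq_dualAnnihilator_ker, Submodule.mem_dualAnnihilator]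
    intro x hx
    have := hA x
    rw [LinearMap.mem_ker.1 hx, norm_zero, mul_zero] at this
    exact norm_le_zero_iff.1 this
  obtain ⟨l', rfl⟩ := hl
  let L : StrongDual ℂ (LinearMap.range ι) :=
    (l'.comp (LinearMap.range ι).subtype).mkContinuous A (by
      rintro ⟨_, x, rfl⟩
      exact hA x)
  obtain ⟨G, hG, -⟩ := exists_extension_norm_eq (LinearMap.range ι) L
  refine ⟨(InnerProductSpace.toDual ℂ H).symm G, fun x => ?_⟩
  rw [InnerProductSpace.toDual_symm_apply]
  exact (hG ⟨ι x, x, rfl⟩).symm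

/-- A distribution whose Fourier transform is square-integrable is a square-integrable function:
by Plancherel's identity it is bounded in `L²` on test functions. -/
theorem exists_memLp_of_hasFourier {g : Distr univ} {F : ℤ → ℝ → ℂ}
    (hF : ∀ k, AEStronglyMeasurable (F k) volume) (hfin : ∑' k, ∫⁻ τ, ‖F k τ‖ₑ ^ 2 ≠ ∞)
    (hg : HasFourier g F) :
    ∃ v : SpaceTime → ℂ, MemLp v 2 volume ∧
      ∀ θ : TestFunctions univ, g.toLin θ = ∫ p, v p * θ.1 p := by
  let ι : TestFunctions univ →ₗ[ℂ] Lp ℂ 2 (volume : Measure SpaceTime) :=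
    { toFun := fun θ => (memLp_testFunction θ 2).toLp θ.1
      map_add' := fun _ _ => rfl
      map_smul' := fun _ _ => rfl }
  set A : ℝ≥0∞ := (∑' k, ∫⁻ τ, ‖F k τ‖ₑ ^ 2) ^ (1 / 2 : ℝ)
  have hAtop : A ≠ ∞ := ENNReal.rpow_ne_top_of_nonneg (by norm_num) hfin
  have hbound : ∀ θ : TestFunctions univ, ‖g.toLin θ‖ ≤ A.toReal * ‖ι θ‖ := fun θ => by
    have hi := integrable_testFunction θ
    have h2 := memLp_testFunction θ 2
    have e1 : ‖g.toLin θ‖ₑ ≤ A * eLpNorm θ.1 2 volume := by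
      rw [hg θ]
      have hrefl : ∑' k : ℤ, ∫⁻ τ : ℝ, ‖fourierST θ.1 (-τ) (-k)‖ₑ ^ 2
          = eLpNorm θ.1 2 volume ^ 2 := by
        rw [eLpNorm_two_sq, ← tsum_lintegral_fourierST hi h2,
          ← (Equiv.neg ℤ).tsum_eq fun k => ∫⁻ τ, ‖fourierST θ.1 τ k‖ₑ ^ 2]
        refine tsum_congr fun k => ?_
        exact lintegral_neg_eq_self (μ := volume) fun τ => ‖fourierST θ.1 τ (-k)‖ₑ ^ 2
      calc _ ≤ ∑' k : ℤ, ‖∫ τ : ℝ, F k τ * fourierST θ.1 (-τ) (-k)‖ₑ := enorm_tsum_le_tsum_enorm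
        _ ≤ ∑' k : ℤ, ∫⁻ τ : ℝ, ‖F k τ‖ₑ * ‖fourierST θ.1 (-τ) (-k)‖ₑ := by
          refine ENNReal.tsum_le_tsum fun k => (enorm_integral_le_lintegral_enorm _).trans ?_
          simp only [enorm_mul, le_refl]
        _ ≤ A * (∑' k : ℤ, ∫⁻ τ : ℝ, ‖fourierST θ.1 (-τ) (-k)‖ₑ ^ 2) ^ (1 / 2 : ℝ) :=
          tsum_lintegral_mul_le (fun k => (hF k).enorm) fun k =>
            ((continuous_fourierST hi (-k)).comp continuous_neg).measurable.enorm.aemeasurable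
        _ = _ := by
          rw [hrefl, ← ENNReal.rpow_natCast, ← ENNReal.rpow_mul]; simp
    have e2 : ‖ι θ‖ = (eLpNorm θ.1 2 volume).toReal := Lp.norm_toLp θ.1 h2
    rw [e2, ← ENNReal.toReal_mul, ← toReal_enorm]
    exact ENNReal.toReal_mono (ENNReal.mul_ne_top hAtop h2.2.ne) e1
  obtain ⟨w, hw⟩ := exists_inner_eq_of_norm_le ι g.toLin A.toReal hbound
  refine ⟨fun p => conj (w p), ?_, fun θ => ?_⟩
  · exact (memLp_congr_norm (Complex.continuous_conj.comp_aestronglyMeasurable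
      (Lp.aestronglyMeasurable w)) (Lp.aestronglyMeasurable w)
      (Eventually.of_forall fun p => RCLike.norm_conj _)).2 (Lp.memLp w)
  · rw [hw, L2.inner_def]
    refine integral_congr_ae ?_
    filter_upwards [(memLp_testFunction θ 2).coeFn_toLp] with p hp
    change inner ℂ (w p) ((memLp_testFunction θ 2).toLp θ.1 p) = _
    rw [hp, RCLike.inner_apply, mul_comm]

/-! ### Localized Fourier transforms -/

/-- A complex test function of time, supported in `(0, T)`. -/
structure TimeTest (T : ℝ) where
  /-- The underlying function. -/
  toFun : ℝ → ℂ
  contDiff : ContDiff ℝ (⊤ : ℕ∞) toFun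
  hasCompactSupport : HasCompactSupport toFun
  tsupport_subset : tsupport toFun ⊆ Ioo 0 T

namespace TimeTest

variable {T : ℝ}

/-- The derivative of a test function. -/
def deriv (φ : TimeTest T) : TimeTest T where
  toFun := _root_.deriv φ.toFun
  contDiff := (contDiff_infty_iff_deriv.1 φ.contDiff).2
  hasCompactSupport := φ.hasCompactSupport.deriv
  tsupport_subset := (closure_minimal support_deriv_subset isClosed_closure).trans
    φ.tsupport_subset

/-- The modulation `t ↦ φ(t) e^{-iσt}` of a test function. -/
def modulate (φ : TimeTest T) (σ : ℝ) : TimeTest T where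
  toFun := fun t => φ.toFun t * Complex.exp (-(Complex.I * t * σ))
  contDiff := φ.contDiff.mul (Complex.contDiff_exp.comp
    (((contDiff_const.mul Complex.ofRealCLM.contDiff).mul contDiff_const).neg))
  hasCompactSupport := φ.hasCompactSupport.mul_right
  tsupport_subset := tsupport_mul_subset_left.trans φ.tsupport_subset

theorem continuous (φ : TimeTest T) : Continuous φ.toFun := φ.contDiff.continuous

/-- The Fourier transform `∫ e^{-itξ} φ(t) dt`. -/
def hat (φ : TimeTest T) (ξ : ℝ) : ℂ := ∫ t : ℝ, Complex.exp (-(Complex.I * t * ξ)) * φ.toFun t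

theorem hat_eq_fourier (φ : TimeTest T) (ξ : ℝ) :
    φ.hat ξ = 𝓕 φ.toFun ((2 * Real.pi)⁻¹ * ξ) := by
  rw [hat, Real.fourier_real_eq_integral_exp_smul]
  refine integral_congr_ae (Eventually.of_forall fun t => ?_)
  simp only [smul_eq_mul]
  congr 2
  push_cast
  have : (Real.pi : ℂ) ≠ 0 := by exact_mod_cast Real.pi_ne_zero
  field_simp

theorem exists_schwartz_fourier (φ : TimeTest T) : ∃ S : SchwartzMap ℝ ℂ, ∀ ξ, 𝓕 φ.toFun ξ = S ξ :=
  ⟨𝓕 (φ.hasCompactSupport.toSchwartzMap φ.contDiff), fun _ => by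
    rw [SchwartzMap.fourier_coe]; rfl⟩

theorem measurable_hat (φ : TimeTest T) : Measurable φ.hat := by
  obtain ⟨S, hS⟩ := φ.exists_schwartz_fourier
  have : φ.hat = fun ξ => S ((2 * Real.pi)⁻¹ * ξ) := funext fun ξ => by rw [hat_eq_fourier, hS]
  rw [this]
  exact (S.continuous.comp (by fun_prop)).measurable

/-- The norm of `φ̂` in `L¹(⟨ξ⟩² dξ)`. -/
def hatNorm (φ : TimeTest T) : ℝ≥0∞ := ∫⁻ ξ, ENNReal.ofReal (1 + ξ ^ 2) * ‖φ.hat ξ‖ₑ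

theorem hatNorm_ne_top (φ : TimeTest T) : φ.hatNorm ≠ ∞ := by
  obtain ⟨S, hS⟩ := φ.exists_schwartz_fourier
  have hpi : (2 * Real.pi) ≠ 0 := Real.two_pi_pos.ne'
  have h1 : Integrable fun x : ℝ => ‖S x‖ + (2 * Real.pi) ^ 2 * (‖x‖ ^ 2 * ‖S x‖) :=
    S.integrable.norm.add ((S.integrable_pow_mul volume 2).const_mul _)
  have h2 := h1.comp_mul_left' (R := (2 * Real.pi)⁻¹) (inv_ne_zero hpi)
  refine (lt_of_le_of_lt (lintegral_mono fun ξ => ?_) h2.2).ne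
  rw [hat_eq_fourier, hS, ← ofReal_norm, ← ENNReal.ofReal_mul (by positivity),
    Real.enorm_of_nonneg (by positivity)]
  refine ENNReal.ofReal_le_ofReal (le_of_eq ?_)
  beta_reduce
  rw [Real.norm_eq_abs ((2 * Real.pi)⁻¹ * ξ), sq_abs, mul_pow]
  field_simp

end TimeTest

/-- The test function `φ(t) ψ(x)` on the slab. -/
def TimeTest.tensor {T : ℝ} (φ : TimeTest T) (ψ : Torus → ℂ)
    (hψ : ContDiff ℝ (⊤ : ℕ∞) fun x : ℝ => ψ x) : TestFunctions (slab T) :=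
  ⟨fun p => φ.toFun p.1 * ψ p.2, by
    have hK : IsCompact (tsupport φ.toFun ×ˢ (univ : Set Torus)) :=
      IsCompact.prod φ.hasCompactSupport isCompact_univ
    have hsub : tsupport (fun p : SpaceTime => φ.toFun p.1 * ψ p.2)
        ⊆ tsupport φ.toFun ×ˢ (univ : Set Torus) := by
      refine closure_minimal (fun p hp => ⟨?_, mem_univ _⟩) hK.isClosed
      exact subset_tsupport _ fun h0 => hp (by simp [h0])
    refine ⟨?_, hK.of_isClosed_subset isClosed_closure hsub, hsub.trans ?_⟩
    · exact (φ.contDiff.comp contDiff_fst).mul (hψ.comp contDiff_snd)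
    · exact prod_mono φ.tsupport_subset subset_rfl⟩

theorem contDiff_fourier (k : ℤ) :
    ContDiff ℝ (⊤ : ℕ∞) fun x : ℝ => (fourier k (x : Torus) : ℂ) := by
  simp only [fourier_coe_apply]
  exact Complex.contDiff_exp.comp
    ((contDiff_const.mul Complex.ofRealCLM.contDiff).div_const _)

/-- The Fourier transform at `(σ, k)` of the localized distribution `φ(t) u`. -/
def locFT {T : ℝ} (u : Distr (slab T)) (φ : TimeTest T) (k : ℤ) (σ : ℝ) : ℂ :=
  u.toLin ((φ.modulate σ).tensor (fourier (-k)) (contDiff_fourier (-k)))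

theorem integral_fourier_mul_fourier (k l : ℤ) :
    ∫ x : Torus, fourier k x * fourier (-l) x = if k = l then ((2 * Real.pi : ℝ) : ℂ) else 0 := by
  have h := congrFun (fourierCoeff_fourier (T := 2 * Real.pi) k) l
  rw [fourierCoeff, AddCircle.integral_haarAddCircle] at h
  have hpi : ((2 * Real.pi : ℝ) : ℂ) ≠ 0 := by exact_mod_cast Real.two_pi_pos.ne'
  have h' : ∫ x : Torus, fourier k x * fourier (-l) x
      = ((2 * Real.pi : ℝ) : ℂ) * (Pi.single k (1 : ℂ) : ℤ → ℂ) l := by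
    rw [← h, Complex.real_smul, Complex.ofReal_inv, mul_inv_cancel_left₀ hpi]
    simp only [smul_eq_mul, mul_comm]
  rw [h', Pi.single_apply]
  by_cases hkl : l = k
  · simp [hkl]
  · simp [hkl, Ne.symm hkl]

theorem fourierST_tensor {T : ℝ} (φ : TimeTest T) (σ τ : ℝ) (k l : ℤ) :
    fourierST ((φ.modulate σ).tensor (fourier (-k)) (contDiff_fourier (-k))).1 (-τ) (-l)
      = if l = k then φ.hat (σ - τ) else 0 := by
  have hpi : ((2 * Real.pi : ℝ) : ℂ) ≠ 0 := by exact_mod_cast Real.two_pi_pos.ne'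
  have h1 : ∀ p : SpaceTime, Complex.exp (-(Complex.I * p.1 * (-τ : ℝ))) * fourier (- -l) p.2 *
      ((φ.modulate σ).tensor (fourier (-k)) (contDiff_fourier (-k))).1 p
      = (Complex.exp (-(Complex.I * p.1 * (σ - τ : ℝ))) * φ.toFun p.1)
        * (fourier l p.2 * fourier (-k) p.2) := fun p => by
    have : Complex.exp (-(Complex.I * p.1 * (σ - τ : ℝ)))
        = Complex.exp (-(Complex.I * p.1 * (-τ : ℝ))) * Complex.exp (-(Complex.I * p.1 * σ)) := by
      rw [← Complex.exp_add]; congr 1; push_cast; ring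
    rw [this, neg_neg]
    simp only [TimeTest.tensor, TimeTest.modulate]
    ring
  rw [fourierST]
  simp only [h1]
  rw [Measure.volume_eq_prod, integral_prod_mul
    (fun t : ℝ => Complex.exp (-(Complex.I * t * (σ - τ : ℝ))) * φ.toFun t)
    (fun x : Torus => fourier l x * fourier (-k) x), integral_fourier_mul_fourier]
  split_ifs with h
  · rw [TimeTest.hat, mul_comm, mul_assoc]
    push_cast at hpi ⊢
    rw [mul_one_div_cancel hpi, mul_one]
  · simp

/-- Multiplication by `φ(t)` is a convolution in `τ`, whichever extension of `u` is used. -/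
theorem locFT_eq_integral {T : ℝ} {u : Distr (slab T)} {g : Distr univ} {F : ℤ → ℝ → ℂ}
    (hgu : Distr.EqOn (subset_univ _) g u) (hg : HasFourier g F) (φ : TimeTest T) (k : ℤ) (σ : ℝ) :
    locFT u φ k σ = ∫ τ, F k τ * φ.hat (σ - τ) := by
  rw [locFT, ← hgu, hg, tsum_eq_single k]
  · refine integral_congr_ae (Eventually.of_forall fun τ => ?_)
    refine congrArg (F k τ * ·) ((fourierST_tensor φ σ τ k k).trans ?_)
    rw [if_pos rfl]
  · intro l hl
    rw [← integral_zero ℝ ℂ]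
    refine integral_congr_ae (Eventually.of_forall fun τ => ?_)
    have : fourierST (TestFunctions.extend (subset_univ _)
        ((φ.modulate σ).tensor (fourier (-k)) (contDiff_fourier (-k)))).1 (-τ) (-l) = 0 :=
      (fourierST_tensor φ σ τ k l).trans (if_neg hl)
    simp only [this, mul_zero]

/-! ### Localization in weighted spaces -/

theorem bracket_rpow (r b : ℝ) : bracket r ^ (2 * b) = (1 + r ^ 2) ^ b := by
  rw [bracket, Real.sqrt_eq_rpow, ← Real.rpow_mul (by positivity)]
  congr 1; ring

theorem bracket_pos (r : ℝ) : 0 < bracket r := Real.sqrt_pos.2 (by positivity)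

theorem one_add_sq_le (x y : ℝ) : 1 + x ^ 2 ≤ 2 * (1 + (x - y) ^ 2) * (1 + y ^ 2) := by
  nlinarith [sq_nonneg (x - 2 * y), sq_nonneg ((x - y) * y)]

/-- Peetre's inequality. -/
theorem bracket_rpow_le {b : ℝ} (hb : |b| ≤ 1) (x y : ℝ) :
    bracket x ^ (2 * b) ≤ 2 * (1 + (x - y) ^ 2) * bracket y ^ (2 * b) := by
  have pos : ∀ c : ℝ, 0 ≤ c → c ≤ 1 → ∀ x y : ℝ,
      (1 + x ^ 2) ^ c ≤ 2 * (1 + (x - y) ^ 2) * (1 + y ^ 2) ^ c := fun c h0 h1 x y => by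
    have h2 : (1 : ℝ) ≤ 2 * (1 + (x - y) ^ 2) := by nlinarith [sq_nonneg (x - y)]
    calc (1 + x ^ 2) ^ c ≤ (2 * (1 + (x - y) ^ 2) * (1 + y ^ 2)) ^ c :=
          Real.rpow_le_rpow (by positivity) (one_add_sq_le x y) h0
      _ = (2 * (1 + (x - y) ^ 2)) ^ c * (1 + y ^ 2) ^ c :=
          Real.mul_rpow (by positivity) (by positivity)
      _ ≤ _ := by
          refine mul_le_mul_of_nonneg_right ?_ (by positivity)
          exact (Real.rpow_le_rpow_of_exponent_le h2 h1).trans_eq (Real.rpow_one _)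
  rw [bracket_rpow, bracket_rpow]
  obtain h | h := le_total 0 b
  · exact pos b h ((le_abs_self b).trans hb) x y
  · have h1 := pos (-b) (by linarith) ((neg_le_abs b).trans hb) y x
    rw [Real.rpow_neg (by positivity), Real.rpow_neg (by positivity), ← neg_sub x y, neg_sq,
      ← div_eq_mul_inv, le_div_iff₀ (by positivity), inv_mul_le_iff₀ (by positivity)] at h1
    linarith

/-- Schur's test for convolution operators in a weighted `L²` space. -/
theorem lintegral_weight_convolution_le {W : ℝ → ℝ≥0∞} (hW : AEMeasurable W)
    {h : ℝ → ℝ≥0∞} (hh : Measurable h) {w : ℝ → ℝ≥0∞} (hw : Measurable w)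
    {m : ℝ → ℝ≥0∞} (hm : Measurable m) (hm1 : ∀ ξ, 1 ≤ m ξ)
    (hwm : ∀ σ τ, w σ ≤ 2 * m (σ - τ) * w τ) :
    ∫⁻ σ, w σ * (∫⁻ τ, W τ * h (σ - τ)) ^ 2
      ≤ 2 * (∫⁻ ξ, m ξ * h ξ) ^ 2 * ∫⁻ τ, w τ * W τ ^ 2 := by
  set K := ∫⁻ ξ, m ξ * h ξ with hK
  have cs : ∀ σ, (∫⁻ τ, W τ * h (σ - τ)) ^ 2 ≤ K * ∫⁻ τ, W τ ^ 2 * h (σ - τ) := fun σ => by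
    have hhσ : Measurable fun τ => h (σ - τ) := hh.comp (measurable_const.sub measurable_id)
    have h1 := ENNReal.lintegral_mul_le_Lp_mul_Lq volume Real.HolderConjugate.two_two
      (f := fun τ => W τ * h (σ - τ) ^ (1 / 2 : ℝ)) (g := fun τ => h (σ - τ) ^ (1 / 2 : ℝ))
      (hW.mul (hhσ.pow_const _).aemeasurable) (hhσ.pow_const _).aemeasurable
    have e1 : ∀ z : ℝ≥0∞, z ^ (1 / 2 : ℝ) * z ^ (1 / 2 : ℝ) = z := fun z => by
      rw [← ENNReal.rpow_add_of_nonneg _ _ (by norm_num) (by norm_num)]; norm_num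
    have e2 : ∀ z : ℝ≥0∞, (z ^ (1 / 2 : ℝ)) ^ (2 : ℝ) = z := fun z => by
      rw [← ENNReal.rpow_mul]; norm_num
    simp only [Pi.mul_apply, mul_assoc, e1, ENNReal.mul_rpow_of_nonneg _ _ (zero_le_two (α := ℝ)),
      e2] at h1
    have h2 := pow_le_pow_left' h1 2
    rw [mul_pow, ← ENNReal.rpow_natCast, ← ENNReal.rpow_natCast, ← ENNReal.rpow_natCast] at h2
    simp only [Nat.cast_ofNat, e2] at h2
    rw [ENNReal.rpow_two, mul_comm] at h2
    simp only [ENNReal.rpow_two] at h2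
    refine h2.trans (mul_le_mul_left ?_ _)
    rw [lintegral_sub_left_eq_self (μ := volume) h σ]
    exact lintegral_mono fun ξ => le_mul_of_one_le_left' (hm1 ξ)
  have hmeas : AEMeasurable (fun p : ℝ × ℝ => w p.1 * (W p.2 ^ 2 * h (p.1 - p.2)))
      (volume.prod volume) :=
    (hw.comp measurable_fst).aemeasurable.mul
      ((hW.comp_snd.pow_const 2).mul (hh.comp (measurable_fst.sub measurable_snd)).aemeasurable)
  calc ∫⁻ σ, w σ * (∫⁻ τ, W τ * h (σ - τ)) ^ 2
      ≤ ∫⁻ σ, K * ∫⁻ τ, w σ * (W τ ^ 2 * h (σ - τ)) := by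
        refine lintegral_mono fun σ => ?_
        have hhσ : Measurable fun τ => h (σ - τ) := hh.comp (measurable_const.sub measurable_id)
        have hWh : AEMeasurable fun τ => W τ ^ 2 * h (σ - τ) :=
          (hW.pow_const 2).mul hhσ.aemeasurable
        rw [lintegral_const_mul'' _ hWh, mul_left_comm]
        exact mul_le_mul_right (cs σ) _
    _ ≤ K * ∫⁻ σ, ∫⁻ τ, w σ * (W τ ^ 2 * h (σ - τ)) := by
        rw [lintegral_const_mul'' _ hmeas.lintegral_prod_right']
    _ = K * ∫⁻ τ, ∫⁻ σ, w σ * (W τ ^ 2 * h (σ - τ)) := by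
        rw [lintegral_lintegral_swap hmeas]
    _ ≤ K * ∫⁻ τ, (2 * K) * (w τ * W τ ^ 2) := by
        refine mul_le_mul_right (lintegral_mono fun τ => ?_) _
        calc ∫⁻ σ, w σ * (W τ ^ 2 * h (σ - τ))
            ≤ ∫⁻ σ, (2 * (w τ * W τ ^ 2)) * (m (σ - τ) * h (σ - τ)) := by
              refine lintegral_mono fun σ => (mul_le_mul_left (hwm σ τ) _).trans_eq ?_
              ring
          _ = _ := by
              have hmh : Measurable fun σ => m (σ - τ) * h (σ - τ) :=
                (hm.mul hh).comp (measurable_id.sub_const τ)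
              rw [lintegral_const_mul _ hmh,
                lintegral_sub_right_eq_self (μ := volume) (fun ξ => m ξ * h ξ) τ, ← hK]
              ring
    _ = _ := by
        have hwW : AEMeasurable fun τ => w τ * W τ ^ 2 := hw.aemeasurable.mul (hW.pow_const 2)
        rw [lintegral_const_mul'' _ hwW]
        ring

/-- Convolution in `τ` with `φ̂` is bounded on `X^{s,b}`, uniformly in the frequency `k`. -/
theorem weightedNorm_convolution_le (j : ℕ) (s : ℝ) {b : ℝ} (hb : |b| ≤ 1) {F : ℤ → ℝ → ℂ}
    (hF : ∀ k, AEStronglyMeasurable (F k) volume) {T : ℝ} (φ : TimeTest T) :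
    weightedNorm j s b (fun k σ => ∫ τ, F k τ * φ.hat (σ - τ))
      ≤ (2 * φ.hatNorm) * weightedNorm j s b F := by
  have key : ∀ k : ℤ, ∫⁻ σ : ℝ,
      ENNReal.ofReal (bracket k ^ (2 * s) * bracket (σ - (k : ℝ) ^ (2 * j + 1)) ^ (2 * b))
        * ‖∫ τ, F k τ * φ.hat (σ - τ)‖ₑ ^ 2
      ≤ (2 * φ.hatNorm) ^ 2 * ∫⁻ τ : ℝ,
      ENNReal.ofReal (bracket k ^ (2 * s) * bracket (τ - (k : ℝ) ^ (2 * j + 1)) ^ (2 * b))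
        * ‖F k τ‖ₑ ^ 2 := fun k => by
    have hbr : Measurable bracket := by unfold bracket; fun_prop
    have h1 := lintegral_weight_convolution_le (W := fun τ => ‖F k τ‖ₑ) (hF k).enorm
      (h := fun ξ => ‖φ.hat ξ‖ₑ) φ.measurable_hat.enorm
      (w := fun τ => ENNReal.ofReal
        (bracket k ^ (2 * s) * bracket (τ - (k : ℝ) ^ (2 * j + 1)) ^ (2 * b)))
      (by fun_prop)
      (m := fun ξ => ENNReal.ofReal (1 + ξ ^ 2)) (by fun_prop)
      (fun ξ => by
        rw [ENNReal.one_le_ofReal]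
        nlinarith [sq_nonneg ξ]) (fun σ τ => by
        have : (2 : ℝ≥0∞) = ENNReal.ofReal 2 := by simp
        rw [this, ← ENNReal.ofReal_mul (by norm_num), ← ENNReal.ofReal_mul (by positivity)]
        refine ENNReal.ofReal_le_ofReal ?_
        have := bracket_rpow_le hb (σ - (k : ℝ) ^ (2 * j + 1)) (τ - (k : ℝ) ^ (2 * j + 1))
        rw [sub_sub_sub_cancel_right] at this
        have hp : 0 ≤ bracket k ^ (2 * s) := (Real.rpow_pos_of_pos (bracket_pos _) _).le
        calc _ ≤ _ := mul_le_mul_of_nonneg_left this hp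
          _ = _ := by ring)
    refine (lintegral_mono fun σ => mul_le_mul_right (pow_le_pow_left' ?_ 2) _).trans
      (h1.trans (mul_le_mul_left ?_ _))
    · refine (enorm_integral_le_lintegral_enorm _).trans ?_
      simp only [enorm_mul, le_refl]
    · rw [mul_pow]
      exact mul_le_mul_left (by norm_num) _
  have h3 : (2 * φ.hatNorm) = ((2 * φ.hatNorm) ^ 2) ^ (1 / 2 : ℝ) := by
    rw [← ENNReal.rpow_natCast, ← ENNReal.rpow_mul]; simp
  rw [weightedNorm, weightedNorm, h3, ← ENNReal.mul_rpow_of_nonneg _ _ (by norm_num)]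
  refine ENNReal.rpow_le_rpow ?_ (by norm_num)
  rw [mul_left_comm, ← ENNReal.tsum_mul_left (a := (2 * φ.hatNorm) ^ 2)]
  exact mul_le_mul_right (ENNReal.tsum_le_tsum key) _

/-- Localization by `φ(t)` is bounded from `X_T^{s,b}` to `X^{s,b}`. -/
theorem weightedNorm_locFT_le (j : ℕ) (s : ℝ) {b : ℝ} (hb : |b| ≤ 1) {T : ℝ} (u : Distr (slab T))
    (φ : TimeTest T) :
    weightedNorm j s b (locFT u φ) ≤ (2 * φ.hatNorm + 1) * xTNorm j T s b u := by
  have htop : 2 * φ.hatNorm ≠ ∞ := ENNReal.mul_ne_top (by norm_num) φ.hatNorm_ne_top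
  -- The summand `1` keeps the constant away from zero, in case the norm on the right is infinite.
  refine ENNReal.le_mul_of_forall_lt (Or.inl (by simp))
    (Or.inl (ENNReal.add_ne_top.2 ⟨htop, by simp⟩)) ?_
  intro a ha c hc
  simp only [xTNorm, xNorm, iInf_lt_iff] at hc
  obtain ⟨g, hgu, F, hF, hg, hlt⟩ := hc
  have := weightedNorm_convolution_le j s hb hF φ
  have e : locFT u φ = fun k σ => ∫ τ, F k τ * φ.hat (σ - τ) := by
    funext k σ; exact locFT_eq_integral hgu hg φ k σ
  rw [e]
  exact this.trans (mul_le_mul' (le_self_add.trans ha.le) hlt.le)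

/-! ### The equation on the Fourier side -/

theorem dt_tensor_modulate {T : ℝ} (φ : TimeTest T) (σ : ℝ) (ψ : Torus → ℂ)
    (hψ : ContDiff ℝ (⊤ : ℕ∞) fun x : ℝ => ψ x) :
    TestFunctions.dt ((φ.modulate σ).tensor ψ hψ)
      = (φ.deriv.modulate σ).tensor ψ hψ - (Complex.I * σ) • (φ.modulate σ).tensor ψ hψ := by
  refine Subtype.ext (funext fun p => ?_)
  have h1 : HasDerivAt (fun t : ℝ => t) 1 p.1 := hasDerivAt_id _
  have h2 : HasDerivAt (fun t : ℝ => Complex.exp (-(Complex.I * t * σ)))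
      (Complex.exp (-(Complex.I * p.1 * σ)) * -(Complex.I * 1 * σ)) p.1 := by
    have h3 := ((h1.ofReal_comp.const_mul Complex.I).mul_const (σ : ℂ)).neg.cexp
    simpa using h3
  have h4 := ((φ.contDiff.differentiable (by simp) p.1).hasDerivAt.mul h2).mul_const (ψ p.2)
  have h5 : deriv (fun h : ℝ => φ.toFun (p.1 + h) * Complex.exp (-(Complex.I * (p.1 + h : ℝ) * σ))
      * ψ p.2) 0
      = (_root_.deriv φ.toFun p.1 * Complex.exp (-(Complex.I * p.1 * σ)) + φ.toFun p.1
        * (Complex.exp (-(Complex.I * p.1 * σ)) * -(Complex.I * 1 * σ))) * ψ p.2 := by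
    refine HasDerivAt.deriv ?_
    have h6 : HasDerivAt (fun h : ℝ => p.1 + h) 1 0 := (hasDerivAt_id _).const_add _
    have h7 := HasDerivAt.scomp (h := fun h : ℝ => p.1 + h) (0 : ℝ)
      (by simpa only [add_zero] using h4) h6
    rw [one_smul] at h7
    exact h7
  refine h5.trans ?_
  change _ = φ.deriv.toFun p.1 * Complex.exp (-(Complex.I * p.1 * σ)) * ψ p.2
    - (Complex.I * σ) * (φ.toFun p.1 * Complex.exp (-(Complex.I * p.1 * σ)) * ψ p.2)
  simp only [TimeTest.deriv]
  ring

theorem dx_tensor_fourier {T : ℝ} (φ : TimeTest T) (k : ℤ) :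
    TestFunctions.dx (φ.tensor (fourier k) (contDiff_fourier k))
      = (Complex.I * k) • φ.tensor (fourier k) (contDiff_fourier k) := by
  refine Subtype.ext (funext fun p => ?_)
  obtain ⟨t, x⟩ := p
  induction x using QuotientAddGroup.induction_on with | H x => ?_
  have h1 := hasDerivAt_fourier (2 * Real.pi) k x
  have h6 : HasDerivAt (fun h : ℝ => x + h) 1 0 := (hasDerivAt_id _).const_add _
  have h7 := (HasDerivAt.scomp (h := fun h : ℝ => x + h) (0 : ℝ)
      (by simpa only [add_zero] using h1) h6).const_mul (φ.toFun t)
  refine h7.deriv.trans ?_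
  change _ = (Complex.I * k) * (φ.toFun t * fourier k (x : Torus))
  have : (Real.pi : ℂ) ≠ 0 := by exact_mod_cast Real.pi_ne_zero
  rw [one_smul]
  push_cast
  field_simp

theorem dx_iterate_tensor_fourier {T : ℝ} (φ : TimeTest T) (k : ℤ) (n : ℕ) :
    TestFunctions.dx^[n] (φ.tensor (fourier k) (contDiff_fourier k))
      = (Complex.I * k) ^ n • φ.tensor (fourier k) (contDiff_fourier k) := by
  have hsmul : ∀ (z : ℂ) (θ : TestFunctions (slab T)),
      TestFunctions.dx (z • θ) = z • TestFunctions.dx θ := fun z θ => by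
    refine Subtype.ext (funext fun p => ?_)
    change deriv (fun h : ℝ => z • θ.1 (p.1, p.2 + (h : Torus))) 0 = z • deriv _ 0
    rw [deriv_fun_const_smul_field]
  induction n with
  | zero => simp
  | succ n ih =>
    rw [Function.iterate_succ_apply', ih, hsmul, dx_tensor_fourier, smul_smul, pow_succ]

/-- The localized equation: on the Fourier side, `∂_t + (-1)^{j+1} ∂_x^{2j+1}` is multiplication by
`i (σ - k^{2j+1})`. -/
theorem locFT_of_solvesLinear {j : ℕ} {T : ℝ} {u f : Distr (slab T)} (h : SolvesLinear j u f)
    (φ : TimeTest T) (k : ℤ) (σ : ℝ) :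
    Complex.I * (σ - (k : ℝ) ^ (2 * j + 1) : ℝ) * locFT u φ k σ
      = locFT f φ k σ + locFT u φ.deriv k σ := by
  have h1 := h ((φ.modulate σ).tensor (fourier (-k)) (contDiff_fourier (-k)))
  rw [dt_tensor_modulate, dx_iterate_tensor_fourier, map_sub, map_smul, map_smul] at h1
  simp only [smul_eq_mul] at h1
  have e : (-1 : ℂ) ^ (j + 1) *
      ((-1 : ℂ) ^ (2 * j + 1) * (Complex.I * ((-k : ℤ) : ℂ)) ^ (2 * j + 1))
      = -Complex.I * k ^ (2 * j + 1) := by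
    have hI : Complex.I ^ (2 * j + 1) = (-1) ^ j * Complex.I := by
      rw [pow_succ, pow_mul, Complex.I_sq]
    have hs : (-1 : ℂ) ^ (j + 1) * (-1) ^ j = -1 := by
      rw [← pow_add, show j + 1 + j = 2 * j + 1 by ring, pow_succ, pow_mul]; simp
    have ho : (-1 : ℂ) ^ (2 * j + 1) * (-(k : ℂ)) ^ (2 * j + 1) = k ^ (2 * j + 1) := by
      rw [← mul_pow]; simp
    rw [mul_pow, hI]
    push_cast
    linear_combination (k : ℂ) ^ (2 * j + 1) * Complex.I * hs
      + (-1 : ℂ) ^ (j + 1) * (-1) ^ j * Complex.I * ho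
  simp only [locFT]
  rw [← h1]
  push_cast at e ⊢
  linear_combination (-u.toLin ((φ.modulate σ).tensor (fourier (-k)) (contDiff_fourier (-k)))) * e

/-! ### Nonresonance -/

theorem sq_pow_le_abs_pow_sub_pow (j : ℕ) {k l : ℤ} (hkl : k ≠ l) (hl : l ≠ 0) :
    (l ^ 2) ^ j ≤ |k ^ (2 * j + 1) - l ^ (2 * j + 1)| := by
  have main : ∀ k l : ℤ, l < k → l ≠ 0 →
      (l ^ 2) ^ j ≤ k ^ (2 * j + 1) - l ^ (2 * j + 1) := fun k l hlt h0 => by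
    have hA : 0 ≤ (k ^ 2) ^ j := by positivity
    have hB : 0 ≤ (l ^ 2) ^ j := by positivity
    rw [pow_succ k, pow_succ l (2 * j), pow_mul k, pow_mul l]
    obtain hpos | hneg := lt_or_gt_of_ne h0
    · obtain hk | hk := le_or_gt 0 k
      · nlinarith
      · have : (k ^ 2) ^ j ≤ (l ^ 2) ^ j := pow_le_pow_left₀ (by positivity) (by nlinarith) j
        nlinarith
    · have : (l ^ 2) ^ j ≤ (k ^ 2) ^ j := pow_le_pow_left₀ (by positivity) (by nlinarith) j
      nlinarith
  have hodd : Odd (2 * j + 1) := odd_two_mul_add_one j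
  obtain h | h := lt_or_gt_of_ne hkl
  · have := main (-k) (-l) (by omega) (by omega)
    rw [hodd.neg_pow, hodd.neg_pow, neg_sq] at this
    rw [abs_sub_comm]
    exact (this.trans_eq (by ring)).trans (le_abs_self _)
  · exact (main k l h hl).trans (le_abs_self _)

theorem one_le_abs_pow_sub_pow (j : ℕ) {k l : ℤ} (hkl : k ≠ l) :
    1 ≤ |k ^ (2 * j + 1) - l ^ (2 * j + 1)| := by
  refine Int.one_le_abs (sub_ne_zero.2 fun h => hkl ?_)
  exact (odd_two_mul_add_one j).strictMono_pow.injective h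

/-- The dispersion relation separates distinct frequencies by at least the order of
`⟨l⟩^{2j}`. -/
theorem one_add_sq_pow_le (j : ℕ) {k l : ℤ} (hkl : k ≠ l) :
    (1 + (l : ℝ) ^ 2) ^ j ≤ 2 ^ j * |(k : ℝ) ^ (2 * j + 1) - (l : ℝ) ^ (2 * j + 1)| := by
  have h1 : (1 : ℝ) ≤ |(k : ℝ) ^ (2 * j + 1) - (l : ℝ) ^ (2 * j + 1)| := by
    exact_mod_cast one_le_abs_pow_sub_pow j hkl
  by_cases hl : l = 0
  · subst hl
    have h2 : (1 : ℝ) ≤ 2 ^ j := one_le_pow₀ (by norm_num)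
    calc (1 + ((0 : ℤ) : ℝ) ^ 2) ^ j = 1 := by simp
      _ ≤ _ := one_le_mul_of_one_le_of_one_le h2 h1
  · have h3 : ((l : ℝ) ^ 2) ^ j ≤ |(k : ℝ) ^ (2 * j + 1) - (l : ℝ) ^ (2 * j + 1)| := by
      exact_mod_cast sq_pow_le_abs_pow_sub_pow j hkl hl
    have h4 : (1 : ℝ) ≤ (l : ℝ) ^ 2 := by
      have : (1 : ℤ) ≤ l ^ 2 :=
        Int.add_one_le_iff.2 (lt_of_le_of_ne (sq_nonneg l) (pow_ne_zero 2 hl).symm)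
      exact_mod_cast this
    calc (1 + (l : ℝ) ^ 2) ^ j ≤ (2 * (l : ℝ) ^ 2) ^ j :=
          pow_le_pow_left₀ (by positivity) (by linarith) j
      _ = 2 ^ j * ((l : ℝ) ^ 2) ^ j := mul_pow _ _ _
      _ ≤ _ := mul_le_mul_of_nonneg_left h3 (by positivity)

/-- The weights of `X^{0,b}` at `(σ, k)` and of `X^{-2j+2jb,-b}` at `(σ, l)` multiply to at least
`|k^{2j+1} - l^{2j+1}|⁻²`, up to a constant. By Peetre's inequality the change of modulation costs
the power `2b` of the resonance function, and `⟨l⟩^{4j(1-b)}` costs the remaining power `2(1-b)`. -/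
theorem one_le_weights (j : ℕ) {b : ℝ} (hb0 : 0 ≤ b) (hb1 : b ≤ 1) {k l : ℤ} (hkl : k ≠ l)
    (σ : ℝ) :
    1 ≤ (2 ^ (j + 1) * |(k : ℝ) ^ (2 * j + 1) - (l : ℝ) ^ (2 * j + 1)|) ^ 2
      * (bracket k ^ (2 * (0 : ℝ)) * bracket (σ - (k : ℝ) ^ (2 * j + 1)) ^ (2 * b))
      * (bracket l ^ (2 * (-2 * j + 2 * j * b))
        * bracket (σ - (l : ℝ) ^ (2 * j + 1)) ^ (2 * -b)) := by
  set N := |(k : ℝ) ^ (2 * j + 1) - (l : ℝ) ^ (2 * j + 1)| with hN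
  have hN1 : 1 ≤ N := by rw [hN]; exact_mod_cast one_le_abs_pow_sub_pow j hkl
  set x := σ - (l : ℝ) ^ (2 * j + 1)
  set y := σ - (k : ℝ) ^ (2 * j + 1)
  have hxy : (x - y) ^ 2 = N ^ 2 := by rw [hN, sq_abs]; simp only [x, y]; ring
  have hx : (1 + x ^ 2) ≤ (4 * N ^ 2) * (1 + y ^ 2) := by
    refine (one_add_sq_le x y).trans ?_
    rw [hxy]
    exact mul_le_mul_of_nonneg_right (by nlinarith) (by positivity)
  have hxb : (1 + x ^ 2) ^ b ≤ (4 * N ^ 2) ^ b * (1 + y ^ 2) ^ b := by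
    rw [← Real.mul_rpow (by positivity) (by positivity)]
    exact Real.rpow_le_rpow (by positivity) hx hb0
  have hl : ((1 + (l : ℝ) ^ 2) ^ j) ^ 2 ≤ 4 ^ j * N ^ 2 := by
    refine (pow_le_pow_left₀ (by positivity) (one_add_sq_pow_le j hkl) 2).trans_eq ?_
    rw [mul_pow, ← pow_mul, mul_comm j, pow_mul]; norm_num [hN]
  have hlb : (((1 + (l : ℝ) ^ 2) ^ j) ^ 2) ^ (1 - b) ≤ (4 ^ j * N ^ 2) ^ (1 - b) :=
    Real.rpow_le_rpow (by positivity) hl (by linarith)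
  have hM : (4 * N ^ 2) ^ b * (4 ^ j * N ^ 2) ^ (1 - b) ≤ (2 ^ (j + 1) * N) ^ 2 := by
    have e1 : (2 ^ (j + 1) * N) ^ 2
        = (4 ^ (j + 1) * N ^ 2) ^ b * (4 ^ (j + 1) * N ^ 2) ^ (1 - b) := by
      rw [← Real.rpow_add (by positivity), add_sub_cancel, Real.rpow_one, mul_pow, ← pow_mul,
        mul_comm (j + 1), pow_mul]
      norm_num
    rw [e1]
    have h4 : (4 : ℝ) ≤ 4 ^ (j + 1) := le_self_pow₀ (by norm_num) (by omega)
    have h5 : (4 : ℝ) ^ j ≤ 4 ^ (j + 1) := pow_le_pow_right₀ (by norm_num) (by omega)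
    refine mul_le_mul ?_ ?_ (by positivity) (by positivity)
    · exact Real.rpow_le_rpow (by positivity) (by gcongr) hb0
    · exact Real.rpow_le_rpow (by positivity) (by gcongr) (by linarith)
  have elb : bracket l ^ (2 * (-2 * j + 2 * j * b))
      = ((((1 + (l : ℝ) ^ 2) ^ j) ^ 2) ^ (1 - b))⁻¹ := by
    rw [bracket_rpow, ← pow_mul, ← Real.rpow_natCast (1 + (l : ℝ) ^ 2) (j * 2),
      ← Real.rpow_mul (by positivity),
      ← Real.rpow_neg (by positivity)]
    congr 1; push_cast; ring
  rw [elb, bracket_rpow, bracket_rpow, bracket_rpow, Real.rpow_zero, one_mul,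
    Real.rpow_neg (by positivity), ← mul_inv, ← div_eq_mul_inv, one_le_div (by positivity)]
  calc _ ≤ (4 ^ j * N ^ 2) ^ (1 - b) * ((4 * N ^ 2) ^ b * (1 + y ^ 2) ^ b) :=
        mul_le_mul hlb hxb (by positivity) (by positivity)
    _ = ((4 * N ^ 2) ^ b * (4 ^ j * N ^ 2) ^ (1 - b)) * (1 + y ^ 2) ^ b := by ring
    _ ≤ _ := mul_le_mul_of_nonneg_right hM (by positivity)

theorem tsum_lintegral_weight (j : ℕ) (s b : ℝ) (F : ℤ → ℝ → ℂ) :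
    (∑' k : ℤ, ∫⁻ τ : ℝ,
      ENNReal.ofReal (bracket k ^ (2 * s) * bracket (τ - (k : ℝ) ^ (2 * j + 1)) ^ (2 * b))
        * ‖F k τ‖ₑ ^ 2) ^ (1 / 2 : ℝ)
      = ENNReal.ofReal (2 * Real.pi) ^ (1 / 2 : ℝ) * weightedNorm j s b F := by
  rw [weightedNorm, ← ENNReal.mul_rpow_of_nonneg _ _ (by norm_num), ← mul_assoc,
    ← ENNReal.ofReal_mul (by positivity), mul_one_div_cancel Real.two_pi_pos.ne',
    ENNReal.ofReal_one, one_mul]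

/-- Off the diagonal, the product of `X^{0,b}` and `X^{-2j+2jb,-b}` is integrable up to the
resonance function `k^{2j+1} - (k-m)^{2j+1}`. -/
theorem tsum_lintegral_shift_le (j : ℕ) {b : ℝ} (hb0 : 0 ≤ b) (hb1 : b ≤ 1) {m : ℤ} (hm : m ≠ 0)
    {U G : ℤ → ℝ → ℂ} (hU : ∀ k, AEMeasurable (U k)) (hG : ∀ k, AEMeasurable (G k)) :
    ∑' k : ℤ, ∫⁻ τ : ℝ, (‖(k : ℝ) ^ (2 * j + 1) - ((k - m : ℤ) : ℝ) ^ (2 * j + 1)‖ₑ)⁻¹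
        * (‖U k τ‖ₑ * ‖G (k - m) τ‖ₑ)
      ≤ ENNReal.ofReal (2 ^ (j + 1) * (2 * Real.pi)) * (weightedNorm j 0 b U
        * weightedNorm j (-2 * j + 2 * j * b) (-b) G) := by
  set w1 : ℤ → ℝ → ℝ := fun k τ =>
    bracket k ^ (2 * (0 : ℝ)) * bracket (τ - (k : ℝ) ^ (2 * j + 1)) ^ (2 * b) with hw1
  set w2 : ℤ → ℝ → ℝ := fun k τ => bracket k ^ (2 * (-2 * j + 2 * j * b))
        * bracket (τ - (k : ℝ) ^ (2 * j + 1)) ^ (2 * -b) with hw2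
  have hbr : Measurable bracket := by unfold bracket; fun_prop
  have p1 : ∀ k τ, 0 < w1 k τ := fun k τ =>
    mul_pos (Real.rpow_pos_of_pos (bracket_pos _) _) (Real.rpow_pos_of_pos (bracket_pos _) _)
  have p2 : ∀ k τ, 0 < w2 k τ := fun k τ =>
    mul_pos (Real.rpow_pos_of_pos (bracket_pos _) _) (Real.rpow_pos_of_pos (bracket_pos _) _)
  have hsq : ∀ (w : ℝ) (z : ℂ), 0 < w →
      (ENNReal.ofReal (Real.sqrt w) * ‖z‖ₑ) ^ 2 = ENNReal.ofReal w * ‖z‖ₑ ^ 2 := fun w z hw => by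
    rw [mul_pow, ← ENNReal.ofReal_pow (Real.sqrt_nonneg _), Real.sq_sqrt hw.le]
  have pt : ∀ (k : ℤ) (τ : ℝ), (‖(k : ℝ) ^ (2 * j + 1) - ((k - m : ℤ) : ℝ) ^ (2 * j + 1)‖ₑ)⁻¹
        * (‖U k τ‖ₑ * ‖G (k - m) τ‖ₑ) ≤ ENNReal.ofReal (2 ^ (j + 1)) *
        ((ENNReal.ofReal (Real.sqrt (w1 k τ)) * ‖U k τ‖ₑ)
          * (ENNReal.ofReal (Real.sqrt (w2 (k - m) τ)) * ‖G (k - m) τ‖ₑ)) := fun k τ => by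
    have hkl : k ≠ k - m := by omega
    have h1 := one_le_weights j hb0 hb1 hkl τ
    set N := |(k : ℝ) ^ (2 * j + 1) - ((k - m : ℤ) : ℝ) ^ (2 * j + 1)| with hN
    have hN1 : 1 ≤ N := by rw [hN]; exact_mod_cast one_le_abs_pow_sub_pow j hkl
    have h2 : 1 ≤ (2 ^ (j + 1) * N) * Real.sqrt (w1 k τ) * Real.sqrt (w2 (k - m) τ) := by
      rw [← Real.sqrt_sq (show 0 ≤ 2 ^ (j + 1) * N by positivity),
        ← Real.sqrt_mul (by positivity),
        ← Real.sqrt_mul (mul_nonneg (by positivity) (p1 _ _).le), Real.one_le_sqrt]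
      exact h1
    have h3 : N⁻¹ ≤ 2 ^ (j + 1) * (Real.sqrt (w1 k τ) * Real.sqrt (w2 (k - m) τ)) := by
      rw [inv_le_iff_one_le_mul₀ (by linarith)]
      linarith
    have h4 : (‖(k : ℝ) ^ (2 * j + 1) - ((k - m : ℤ) : ℝ) ^ (2 * j + 1)‖ₑ)⁻¹
        ≤ ENNReal.ofReal (2 ^ (j + 1)) * (ENNReal.ofReal (Real.sqrt (w1 k τ))
          * ENNReal.ofReal (Real.sqrt (w2 (k - m) τ))) := by
      rw [← ofReal_norm, Real.norm_eq_abs, ← hN, ← ENNReal.ofReal_inv_of_pos (by linarith),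
        ← ENNReal.ofReal_mul (by positivity), ← ENNReal.ofReal_mul (by positivity)]
      exact ENNReal.ofReal_le_ofReal h3
    refine (mul_le_mul_left h4 _).trans_eq ?_
    ring
  have hm1 : ∀ k, AEMeasurable fun τ => ENNReal.ofReal (Real.sqrt (w1 k τ)) * ‖U k τ‖ₑ := fun k =>
    (Measurable.aemeasurable (by simp only [hw1]; fun_prop)).mul (hU k).enorm
  have hm2 : ∀ k, AEMeasurable fun τ => ENNReal.ofReal (Real.sqrt (w2 k τ)) * ‖G k τ‖ₑ := fun k =>
    (Measurable.aemeasurable (by simp only [hw2]; fun_prop)).mul (hG k).enorm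
  have cs := tsum_lintegral_mul_le hm1 fun k => hm2 (k - m)
  have e2 : ∑' k : ℤ, ∫⁻ τ, (ENNReal.ofReal (Real.sqrt (w2 (k - m) τ)) * ‖G (k - m) τ‖ₑ) ^ 2
      = ∑' k : ℤ, ∫⁻ τ, (ENNReal.ofReal (Real.sqrt (w2 k τ)) * ‖G k τ‖ₑ) ^ 2 :=
    (Equiv.subRight m).tsum_eq
      fun k => ∫⁻ τ, (ENNReal.ofReal (Real.sqrt (w2 k τ)) * ‖G k τ‖ₑ) ^ 2
  rw [e2] at cs
  simp only [hsq _ _ (p1 _ _), hsq _ _ (p2 _ _)] at cs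
  simp only [hw1, hw2] at cs
  rw [tsum_lintegral_weight, tsum_lintegral_weight] at cs
  have e3 : ENNReal.ofReal (2 * Real.pi) ^ (1 / 2 : ℝ) * ENNReal.ofReal (2 * Real.pi) ^ (1 / 2 : ℝ)
      = ENNReal.ofReal (2 * Real.pi) := by
    rw [← ENNReal.rpow_add_of_nonneg _ _ (by norm_num) (by norm_num)]; norm_num
  calc _ ≤ ∑' k : ℤ, ∫⁻ τ, ENNReal.ofReal (2 ^ (j + 1)) *
        ((ENNReal.ofReal (Real.sqrt (w1 k τ)) * ‖U k τ‖ₑ)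
          * (ENNReal.ofReal (Real.sqrt (w2 (k - m) τ)) * ‖G (k - m) τ‖ₑ)) :=
        ENNReal.tsum_le_tsum fun k => lintegral_mono fun τ => pt k τ
    _ = ENNReal.ofReal (2 ^ (j + 1)) * ∑' k : ℤ, ∫⁻ τ,
        ((ENNReal.ofReal (Real.sqrt (w1 k τ)) * ‖U k τ‖ₑ)
          * (ENNReal.ofReal (Real.sqrt (w2 (k - m) τ)) * ‖G (k - m) τ‖ₑ)) := by
        rw [← ENNReal.tsum_mul_left]
        exact tsum_congr fun k => lintegral_const_mul' _ _ ENNReal.ofReal_ne_top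
    _ ≤ _ := mul_le_mul_right cs _
    _ = _ := by
        rw [mul_mul_mul_comm, e3, ENNReal.ofReal_mul (p := 2 ^ (j + 1)) (by positivity),
          mul_assoc (ENNReal.ofReal (2 ^ (j + 1)))]

/-- The off-diagonal correlations of a localized solution are controlled by the equation: the
resonance function is nonzero, so that it can be divided out, and no derivative is lost. -/
theorem tsum_lintegral_locFT_shift_le {j : ℕ} {b : ℝ} (hb0 : 0 ≤ b) (hb1 : b ≤ 1) {m : ℤ}
    (hm : m ≠ 0) {T : ℝ} {u f : Distr (slab T)} (heq : SolvesLinear j u f) (φ : TimeTest T)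
    (hU : ∀ k, Measurable (locFT u φ k)) (hU' : ∀ k, Measurable (locFT u φ.deriv k)) :
    ∑' k : ℤ, ∫⁻ τ : ℝ, ‖locFT u φ k τ‖ₑ * ‖locFT u φ (k - m) τ‖ₑ
      ≤ 2 * ENNReal.ofReal (2 ^ (j + 1) * (2 * Real.pi)) * (weightedNorm j 0 b (locFT u φ)
        * (weightedNorm j (-2 * j + 2 * j * b) (-b) (locFT f φ)
          + weightedNorm j (-2 * j + 2 * j * b) (-b) (locFT u φ.deriv))) := by
  set U := locFT u φ
  set U' := locFT u φ.deriv
  set F := locFT f φ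
  have hFU : ∀ (k : ℤ) (τ : ℝ),
      Complex.I * (τ - (k : ℝ) ^ (2 * j + 1) : ℝ) * U k τ = F k τ + U' k τ :=
    fun k τ => locFT_of_solvesLinear heq φ k τ
  have hF : ∀ k, Measurable (F k) := fun k => by
    have : F k = fun τ => Complex.I * (τ - (k : ℝ) ^ (2 * j + 1) : ℝ) * U k τ - U' k τ :=
      funext fun τ => by rw [hFU]; ring
    rw [this]
    have := hU k
    have := hU' k
    fun_prop
  set ν : ℤ → ℤ → ℝ≥0∞ := fun k l =>
    (‖(k : ℝ) ^ (2 * j + 1) - (l : ℝ) ^ (2 * j + 1)‖ₑ)⁻¹ with hν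
  have hνs : ∀ k l, ν k l = ν l k := fun k l => by
    simp only [hν]
    rw [← enorm_neg, neg_sub]
  have pt : ∀ (k : ℤ) (τ : ℝ), ‖U k τ‖ₑ * ‖U (k - m) τ‖ₑ ≤
      (ν k (k - m) * (‖U k τ‖ₑ * ‖F (k - m) τ‖ₑ) + ν k (k - m) * (‖U k τ‖ₑ * ‖U' (k - m) τ‖ₑ))
      + (ν k (k - m) * (‖U (k - m) τ‖ₑ * ‖F k τ‖ₑ)
        + ν k (k - m) * (‖U (k - m) τ‖ₑ * ‖U' k τ‖ₑ)) := fun k τ => by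
    have hkl : k ≠ k - m := by omega
    set N : ℝ := (k : ℝ) ^ (2 * j + 1) - ((k - m : ℤ) : ℝ) ^ (2 * j + 1) with hN
    have hN0 : N ≠ 0 := by
      have : (1 : ℝ) ≤ |N| := by rw [hN]; exact_mod_cast one_le_abs_pow_sub_pow j hkl
      exact abs_pos.1 (by linarith)
    have e1 : (N : ℂ) * (U k τ * conj (U (k - m) τ))
        = Complex.I * ((F k τ + U' k τ) * conj (U (k - m) τ)
          + U k τ * conj (F (k - m) τ + U' (k - m) τ)) := by
      rw [← hFU, ← hFU, map_mul, map_mul, Complex.conj_I, Complex.conj_ofReal, hN]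
      push_cast
      linear_combination (U k τ * conj (U (k - m) τ)
        * ((k : ℂ) ^ (2 * j + 1) - ((k : ℂ) - m) ^ (2 * j + 1))) * Complex.I_sq
    have e2 : ‖N‖ₑ * (‖U k τ‖ₑ * ‖U (k - m) τ‖ₑ)
        ≤ (‖F k τ‖ₑ + ‖U' k τ‖ₑ) * ‖U (k - m) τ‖ₑ
          + ‖U k τ‖ₑ * (‖F (k - m) τ‖ₑ + ‖U' (k - m) τ‖ₑ) := by
      have hc : ∀ z : ℂ, ‖conj z‖ₑ = ‖z‖ₑ := fun z => by
        rw [← ofReal_norm, RCLike.norm_conj, ofReal_norm]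
      have hNc : ‖(N : ℂ)‖ₑ = ‖N‖ₑ := by rw [← ofReal_norm, Complex.norm_real, ofReal_norm]
      have hI : ‖Complex.I‖ₑ = 1 := by rw [← ofReal_norm, Complex.norm_I, ENNReal.ofReal_one]
      have e3 := congrArg (fun z : ℂ => ‖z‖ₑ) e1
      simp only [enorm_mul, hc, hNc, hI, one_mul] at e3
      rw [e3]
      refine (enorm_add_le _ _).trans (add_le_add ?_ ?_)
      · rw [enorm_mul, hc]
        exact mul_le_mul_left (enorm_add_le _ _) _
      · rw [enorm_mul, hc]
        exact mul_le_mul_right (enorm_add_le _ _) _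
    have hNe : ‖N‖ₑ ≠ 0 := by simpa using hN0
    calc ‖U k τ‖ₑ * ‖U (k - m) τ‖ₑ = ‖N‖ₑ⁻¹ * (‖N‖ₑ * (‖U k τ‖ₑ * ‖U (k - m) τ‖ₑ)) := by
          rw [← mul_assoc, ENNReal.inv_mul_cancel hNe enorm_ne_top, one_mul]
      _ ≤ _ := mul_le_mul_right e2 _
      _ = _ := by
          have : ν k (k - m) = ‖N‖ₑ⁻¹ := rfl
          rw [this]; ring
  have mU := fun k => (hU k).aemeasurable (μ := volume)
  have mU' := fun k => (hU' k).aemeasurable (μ := volume)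
  have mF := fun k => (hF k).aemeasurable (μ := volume)
  have b1 := tsum_lintegral_shift_le j hb0 hb1 hm mU mF
  have b2 := tsum_lintegral_shift_le j hb0 hb1 hm mU mU'
  -- The terms in which `G` sits at `k` are the others with `m` replaced by `-m`.
  have refl : ∀ G : ℤ → ℝ → ℂ, ∑' k : ℤ, ∫⁻ τ : ℝ, ν k (k - m) * (‖U (k - m) τ‖ₑ * ‖G k τ‖ₑ)
      = ∑' k : ℤ, ∫⁻ τ : ℝ, ν k (k - -m) * (‖U k τ‖ₑ * ‖G (k - -m) τ‖ₑ) := fun G => by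
    rw [← (Equiv.subRight m).tsum_eq fun k =>
      ∫⁻ τ : ℝ, ν k (k - -m) * (‖U k τ‖ₑ * ‖G (k - -m) τ‖ₑ)]
    refine tsum_congr fun k => ?_
    simp only [Equiv.subRight_apply, sub_neg_eq_add, sub_add_cancel]
    rw [hνs]
  have b3 := tsum_lintegral_shift_le j hb0 hb1 (neg_ne_zero.2 hm) mU mF
  have b4 := tsum_lintegral_shift_le j hb0 hb1 (neg_ne_zero.2 hm) mU mU'
  have hsplit : ∀ A B : ℤ → ℝ → ℝ≥0∞, (∀ k, Measurable (A k)) →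
      ∑' k, ∫⁻ τ, (A k τ + B k τ) = (∑' k, ∫⁻ τ, A k τ) + ∑' k, ∫⁻ τ, B k τ := fun A B hA => by
    rw [← ENNReal.tsum_add]
    exact tsum_congr fun k => lintegral_add_left (hA k) _
  refine (ENNReal.tsum_le_tsum fun k => lintegral_mono fun τ => pt k τ).trans ?_
  have m1 : ∀ k, Measurable fun τ => ν k (k - m) * (‖U k τ‖ₑ * ‖F (k - m) τ‖ₑ) := fun k =>
    ((hU k).enorm.mul (hF _).enorm).const_mul _
  have m2 : ∀ k, Measurable fun τ => ν k (k - m) * (‖U k τ‖ₑ * ‖U' (k - m) τ‖ₑ) := fun k =>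
    ((hU k).enorm.mul (hU' _).enorm).const_mul _
  have m3 : ∀ k, Measurable fun τ => ν k (k - m) * (‖U (k - m) τ‖ₑ * ‖F k τ‖ₑ) := fun k =>
    ((hU _).enorm.mul (hF _).enorm).const_mul _
  have m12 : ∀ k, Measurable fun τ => ν k (k - m) * (‖U k τ‖ₑ * ‖F (k - m) τ‖ₑ)
      + ν k (k - m) * (‖U k τ‖ₑ * ‖U' (k - m) τ‖ₑ) := fun k => (m1 k).add (m2 k)
  rw [hsplit _ _ m12, hsplit _ _ m1, hsplit _ _ m3, refl, refl]
  refine (add_le_add (add_le_add b1 b2) (add_le_add b3 b4)).trans_eq ?_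
  ring

/-! ### Localized solutions as square-integrable functions -/

theorem one_le_bracket_rpow {b : ℝ} (hb : 0 ≤ b) (r : ℝ) : 1 ≤ bracket r ^ (2 * b) := by
  rw [bracket_rpow]
  exact Real.one_le_rpow (by nlinarith [sq_nonneg r]) hb

theorem tsum_lintegral_le_weightedNorm (j : ℕ) {b : ℝ} (hb : 0 ≤ b) (F : ℤ → ℝ → ℂ) :
    (∑' k : ℤ, ∫⁻ τ : ℝ, ‖F k τ‖ₑ ^ 2) ^ (1 / 2 : ℝ)
      ≤ ENNReal.ofReal (2 * Real.pi) ^ (1 / 2 : ℝ) * weightedNorm j 0 b F := by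
  rw [← tsum_lintegral_weight]
  refine ENNReal.rpow_le_rpow (ENNReal.tsum_le_tsum fun k => lintegral_mono fun τ => ?_)
    (by norm_num)
  refine le_mul_of_one_le_left' (ENNReal.one_le_ofReal.2 ?_)
  rw [mul_zero, Real.rpow_zero, one_mul]
  exact one_le_bracket_rpow hb _

/-- The elements of `X_T^{0,b}` with `b ≥ 0` are square-integrable functions. -/
theorem exists_memLp_of_memXT {j : ℕ} {T b : ℝ} (hb : 0 ≤ b) {u : Distr (slab T)}
    (hu : MemXT j T 0 b u) :
    ∃ v : SpaceTime → ℂ, MemLp v 2 volume ∧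
      ∀ θ : TestFunctions (slab T), u.toLin θ = ∫ p, v p * θ.1 p := by
  simp only [MemXT, xTNorm, xNorm, iInf_lt_iff] at hu
  obtain ⟨g, hgu, F, hF, hg, hlt⟩ := hu
  have hfin : ∑' k, ∫⁻ τ, ‖F k τ‖ₑ ^ 2 ≠ ∞ := fun htop => by
    have h := tsum_lintegral_le_weightedNorm j hb F
    rw [htop, ENNReal.top_rpow_of_pos (by norm_num), top_le_iff] at h
    exact ENNReal.mul_ne_top (ENNReal.rpow_ne_top_of_nonneg (by norm_num) ENNReal.ofReal_ne_top)
      hlt.ne h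
  obtain ⟨v, hv, hgv⟩ := exists_memLp_of_hasFourier hF hfin hg
  exact ⟨v, hv, fun θ => by rw [← hgu θ, hgv]; rfl⟩

theorem memLp_testFunction_mul {U : Set SpaceTime} (θ : TestFunctions U) {v : SpaceTime → ℂ}
    (hv : MemLp v 2) : MemLp (fun p => θ.1 p * v p) 2 :=
  hv.mul (memLp_testFunction θ ∞)

theorem integrable_testFunction_mul {U : Set SpaceTime} (θ : TestFunctions U) {v : SpaceTime → ℂ}
    (hv : MemLp v 2) : Integrable (fun p => θ.1 p * v p) :=
  (memLp_testFunction θ 2).integrable_mul hv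

/-- The function `φ(t) ψ(x) v(t, x)`. -/
def cut {T : ℝ} (φ : TimeTest T) (ψ : Torus → ℂ) (v : SpaceTime → ℂ) : SpaceTime → ℂ :=
  fun p => φ.toFun p.1 * ψ p.2 * v p

theorem memLp_cut {T : ℝ} (φ : TimeTest T) {ψ : Torus → ℂ}
    (hψ : ContDiff ℝ (⊤ : ℕ∞) fun x : ℝ => ψ x) {v : SpaceTime → ℂ} (hv : MemLp v 2) :
    MemLp (cut φ ψ v) 2 :=
  memLp_testFunction_mul (φ.tensor ψ hψ) hv

theorem integrable_cut {T : ℝ} (φ : TimeTest T) {ψ : Torus → ℂ}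
    (hψ : ContDiff ℝ (⊤ : ℕ∞) fun x : ℝ => ψ x) {v : SpaceTime → ℂ} (hv : MemLp v 2) :
    Integrable (cut φ ψ v) :=
  integrable_testFunction_mul (φ.tensor ψ hψ) hv

/-- If `u` is the function `v`, then testing `u` against `φ(t) ψ(x) e^{-iσt} e^{-ikx}` gives the
Fourier transform of `φ ψ v`. -/
theorem integral_mul_tensor_modulate {T : ℝ} (φ : TimeTest T) (ψ : Torus → ℂ) (v : SpaceTime → ℂ)
    (k : ℤ) (σ : ℝ) {χ : Torus → ℂ} (hχ : ContDiff ℝ (⊤ : ℕ∞) fun x : ℝ => χ x)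
    (h : ∀ x, χ x = fourier (-k) x * ψ x) :
    ∫ p, v p * ((φ.modulate σ).tensor χ hχ).1 p
      = (2 * Real.pi : ℂ) * dualFT (cut φ ψ v) (k, σ) := by
  have hpi : (2 * Real.pi : ℂ) ≠ 0 := by exact_mod_cast Real.two_pi_pos.ne'
  rw [dualFT, fourierST, ← mul_assoc, mul_one_div_cancel hpi, one_mul]
  refine integral_congr_ae (Eventually.of_forall fun p => ?_)
  simp only [TimeTest.tensor, TimeTest.modulate, h, cut]
  ring

/-! ### Limits of densities on the torus -/

/-- The linear form `h ↦ ∫∫ h(x) G(t, x) dt dx` on `C(𝕋)`. -/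
def densityForm (G : SpaceTime → ℂ) (hG : Integrable G) : C(Torus, ℂ) →ₗ[ℂ] ℂ where
  toFun h := ∫ p, h p.2 * G p
  map_add' h₁ h₂ := by
    have hi : ∀ h : C(Torus, ℂ), Integrable fun p : SpaceTime => h p.2 * G p := fun h =>
      hG.bdd_mul (c := ‖h‖) (Continuous.aestronglyMeasurable (by fun_prop))
        (Eventually.of_forall fun p => h.norm_coe_le_norm p.2)
    rw [← integral_add (hi h₁) (hi h₂)]
    simp only [ContinuousMap.add_apply, add_mul]
  map_smul' c h := by
    simp only [ContinuousMap.smul_apply, smul_eq_mul, mul_assoc, integral_const_mul,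
      RingHom.id_apply]

theorem norm_densityForm_le {G : SpaceTime → ℂ} (hG : Integrable G) (h : C(Torus, ℂ)) :
    ‖densityForm G hG h‖ ≤ (∫ p, ‖G p‖) * ‖h‖ := by
  refine (norm_integral_le_of_norm_le (hG.norm.const_mul ‖h‖) (Eventually.of_forall fun p => ?_)
    ).trans_eq ((integral_const_mul _ _).trans (mul_comm _ _))
  rw [norm_mul]
  exact mul_le_mul_of_nonneg_right (h.norm_coe_le_norm p.2) (norm_nonneg _)

/-- If the nonzero Fourier modes of a bounded sequence of linear forms on `C(𝕋)` tend to zero, then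
these forms become proportional to the integral. -/
theorem tendsto_sub_integral_mul {L : ℕ → C(Torus, ℂ) →ₗ[ℂ] ℂ} {M : ℝ}
    (hM : ∀ n h, ‖L n h‖ ≤ M * ‖h‖)
    (h0 : ∀ m : ℤ, m ≠ 0 → Tendsto (fun n => L n (fourier m)) atTop (𝓝 0)) (h : C(Torus, ℂ)) :
    Tendsto (fun n => ((2 * Real.pi : ℝ) : ℂ) * L n h - (∫ x, h x) * L n 1) atTop (𝓝 0) := by
  have hint : ∀ h : C(Torus, ℂ), Integrable h := fun h =>
    h.continuous.integrable_of_hasCompactSupport (HasCompactSupport.of_compactSpace _)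
  let D : ℕ → C(Torus, ℂ) → ℂ := fun n h => ((2 * Real.pi : ℝ) : ℂ) * L n h - (∫ x, h x) * L n 1
  have hDadd : ∀ n h₁ h₂, D n (h₁ + h₂) = D n h₁ + D n h₂ := fun n h₁ h₂ => by
    have : ∫ x, (h₁ + h₂) x = (∫ x, h₁ x) + ∫ x, h₂ x := integral_add (hint h₁) (hint h₂)
    simp only [D, map_add, this]; ring
  have hDsmul : ∀ n (c : ℂ) h, D n (c • h) = c * D n h := fun n c h => by
    have : ∫ x, (c • h) x = c * ∫ x, h x := integral_const_mul c _
    simp only [D, map_smul, this, smul_eq_mul]; ring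
  have hpi : (0 : ℝ) < 2 * Real.pi := Real.two_pi_pos
  have hvol : (volume : Measure Torus).real univ = 2 * Real.pi := by
    rw [measureReal_def, AddCircle.measure_univ, ENNReal.toReal_ofReal hpi.le]
  have hM0 : 0 ≤ M := by simpa using (norm_nonneg _).trans (hM 0 1)
  have hDb : ∀ n h, ‖D n h‖ ≤ (4 * Real.pi * M) * ‖h‖ := fun n h => by
    have h1 : ‖((2 * Real.pi : ℝ) : ℂ) * L n h‖ ≤ 2 * Real.pi * (M * ‖h‖) := by
      rw [norm_mul, Complex.norm_real, Real.norm_of_nonneg hpi.le]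
      exact mul_le_mul_of_nonneg_left (hM n h) hpi.le
    have h2 : ‖∫ x, h x‖ ≤ ‖h‖ * (2 * Real.pi) := by
      refine (norm_integral_le_of_norm_le_const
        (Eventually.of_forall h.norm_coe_le_norm)).trans_eq ?_
      rw [hvol]
    have h3 : ‖L n 1‖ ≤ M := by simpa using hM n 1
    have h4 : ‖(∫ x, h x) * L n 1‖ ≤ ‖h‖ * (2 * Real.pi) * M := by
      rw [norm_mul]
      exact mul_le_mul h2 h3 (norm_nonneg _) (by positivity)
    refine (norm_sub_le _ _).trans ((add_le_add h1 h4).trans_eq ?_)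
    ring
  let S : Submodule ℂ C(Torus, ℂ) :=
    { carrier := {h | Tendsto (fun n => D n h) atTop (𝓝 0)}
      zero_mem' := by simp [D]
      add_mem' := fun {h₁ h₂} k₁ k₂ => by
        simpa only [mem_ofPred_eq, hDadd, add_zero] using Tendsto.add k₁ k₂
      smul_mem' := fun c h k => by
        simpa only [mem_ofPred_eq, hDsmul, mul_zero] using Tendsto.const_mul c k }
  have hSclosed : IsClosed (S : Set C(Torus, ℂ)) := by
    refine isClosed_of_closure_subset fun h hh => ?_
    refine Metric.tendsto_atTop.2 fun ε hε => ?_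
    have hK : 0 < 4 * Real.pi * M + 1 := by have := Real.pi_pos; positivity
    obtain ⟨h', hh', hd⟩ := Metric.mem_closure_iff.1 hh (ε / 2 / (4 * Real.pi * M + 1))
      (by positivity)
    obtain ⟨n₀, hn₀⟩ := Metric.tendsto_atTop.1 hh' (ε / 2) (by positivity)
    refine ⟨n₀, fun n hn => ?_⟩
    have e1 : D n h = D n (h - h') + D n h' := by rw [← hDadd, sub_add_cancel]
    have e2 := hn₀ n hn
    rw [dist_zero_right] at e2 ⊢
    rw [dist_eq_norm, lt_div_iff₀ hK] at hd
    have e3 := hDb n (h - h')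
    rw [e1]
    refine (norm_add_le _ _).trans_lt ?_
    nlinarith [norm_nonneg (h - h')]
  have hfour : Submodule.span ℂ (range (fourier (T := 2 * Real.pi))) ≤ S := by
    rw [Submodule.span_le]
    rintro _ ⟨m, rfl⟩
    change Tendsto (fun n => D n (fourier m)) atTop (𝓝 0)
    have hi := integral_fourier_mul_fourier m 0
    simp only [neg_zero, fourier_zero, mul_one] at hi
    by_cases hm : m = 0
    · subst hm
      rw [if_pos rfl] at hi
      have hone : fourier (T := 2 * Real.pi) 0 = 1 := ContinuousMap.ext fun x => fourier_zero
      have hz : ∀ n, D n (fourier 0) = 0 := fun n => by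
        simp only [D, hi]
        rw [hone, sub_self]
      simp only [hz, tendsto_const_nhds]
    · simp only [D, hi, if_neg hm, zero_mul, sub_zero]
      simpa using (h0 m hm).const_mul ((2 * Real.pi : ℝ) : ℂ)
  have htop := Submodule.topologicalClosure_minimal _ hfour hSclosed
  rw [span_fourier_closure_eq_top] at htop
  exact htop (Submodule.mem_top : h ∈ ⊤)

/-- A smooth cutoff function supported in a given open subset of the torus: a smooth function of
`cos (x - a)`, where `a` is a point of the set. -/
theorem exists_smooth_tsupport_subset {ω : Set Torus} (hωo : IsOpen ω) (hωn : ω.Nonempty) :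
    ∃ ψ : C(Torus, ℂ), ContDiff ℝ (⊤ : ℕ∞) (fun x : ℝ => ψ (x : Torus)) ∧ tsupport ψ ⊆ ω ∧
      (∀ x, ‖ψ x‖ ≤ 1) ∧ ∫ x, ψ x * conj (ψ x) ≠ 0 := by
  obtain ⟨a, ha⟩ := hωn
  induction a using QuotientAddGroup.induction_on with | H a => ?_
  let C : Torus → ℝ := fun x => (fourier 1 (x - (a : Torus)) : ℂ).re
  have hC : Continuous C := by
    have : Continuous fun x : Torus => (fourier 1 (x - (a : Torus)) : ℂ) := by fun_prop
    exact Complex.continuous_re.comp this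
  have hCx : ∀ x : ℝ, C (x : Torus) = Real.cos (x - a) := fun x => by
    have hp : (Real.pi : ℂ) ≠ 0 := by exact_mod_cast Real.pi_ne_zero
    have e : 2 * (Real.pi : ℂ) * Complex.I * (1 : ℤ) * ((x - a : ℝ) : ℂ) / ((2 * Real.pi : ℝ) : ℂ)
        = ((x - a : ℝ) : ℂ) * Complex.I := by
      push_cast; field_simp
    simp only [C]
    rw [← AddCircle.coe_sub, fourier_coe_apply, e, Complex.exp_ofReal_mul_I_re]
  have hlt : ∀ x ∈ ωᶜ, C x < 1 := fun x hx => by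
    induction x using QuotientAddGroup.induction_on with | H x => ?_
    rw [hCx]
    refine lt_of_le_of_ne (Real.cos_le_one _) fun h => hx ?_
    obtain ⟨n, hn⟩ := (Real.cos_eq_one_iff _).1 h
    have hxa : (x : Torus) = (a : Torus) := by
      rw [← sub_eq_zero, ← AddCircle.coe_sub, AddCircle.coe_eq_zero_iff]
      exact ⟨n, by rw [← hn, zsmul_eq_mul]⟩
    exact hxa ▸ ha
  obtain ⟨c, hc1, hc⟩ : ∃ c < 1, ∀ x ∈ ωᶜ, C x < c := by
    obtain he | he := (ωᶜ).eq_empty_or_nonempty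
    · exact ⟨0, zero_lt_one, by simp [he]⟩
    · obtain ⟨x₀, hx₀, hmax⟩ := hωo.isClosed_compl.isCompact.exists_isMaxOn he hC.continuousOn
      obtain ⟨c, h1, h2⟩ := exists_between (hlt x₀ hx₀)
      exact ⟨c, h2, fun x hx => (hmax hx).trans_lt h1⟩
  have hcont : Continuous fun x : Torus => ((Real.smoothTransition (C x - c) : ℝ) : ℂ) :=
    Complex.continuous_ofReal.comp (Real.smoothTransition.continuous.comp (hC.sub continuous_const))
  have hnorm : ∀ x, ‖((Real.smoothTransition (C x - c) : ℝ) : ℂ)‖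
      = Real.smoothTransition (C x - c) :=
    fun x => by rw [Complex.norm_real, Real.norm_of_nonneg (Real.smoothTransition.nonneg _)]
  refine ⟨⟨_, hcont⟩, ?_, ?_, fun x => ?_, ?_⟩
  · change ContDiff ℝ (⊤ : ℕ∞) fun x : ℝ => ((Real.smoothTransition (C (x : Torus) - c) : ℝ) : ℂ)
    simp only [hCx]
    exact Complex.ofRealCLM.contDiff.comp (Real.smoothTransition.contDiff.comp
      ((Real.contDiff_cos.comp (contDiff_id.sub contDiff_const)).sub contDiff_const))
  · have hsub : tsupport (fun x : Torus => ((Real.smoothTransition (C x - c) : ℝ) : ℂ))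
        ⊆ {x | c ≤ C x} := by
      refine closure_minimal (fun x hx => ?_) (isClosed_le continuous_const hC)
      by_contra hn
      refine hx ?_
      have : C x - c ≤ 0 := by
        have : ¬ c ≤ C x := hn
        linarith
      simp [Real.smoothTransition.zero_of_nonpos this]
    intro x hx
    by_contra hn
    exact absurd (hsub hx) (not_le.2 (hc x hn))
  · exact (hnorm x).trans_le (Real.smoothTransition.le_one _)
  · have hpos : 0 < ∫ x : Torus, Real.smoothTransition (C x - c) ^ 2 := by
      refine Continuous.integral_pos_of_hasCompactSupport_nonneg_nonzero (x := (a : Torus))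
        ((Real.smoothTransition.continuous.comp (hC.sub continuous_const)).pow 2)
        (HasCompactSupport.of_compactSpace _) (fun x => by positivity) ?_
      rw [hCx, sub_self, Real.cos_zero]
      exact pow_ne_zero 2 (Real.smoothTransition.pos_of_pos (by linarith)).ne'
    have heq : ∫ x : Torus, ((Real.smoothTransition (C x - c) : ℝ) : ℂ)
          * conj ((Real.smoothTransition (C x - c) : ℝ) : ℂ)
        = ((∫ x : Torus, Real.smoothTransition (C x - c) ^ 2 : ℝ) : ℂ) := by
      rw [← integral_complex_ofReal]
      refine integral_congr_ae (Eventually.of_forall fun x => ?_)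
      simp only [Complex.conj_ofReal, sq, Complex.ofReal_mul]
    change ∫ x : Torus, ((Real.smoothTransition (C x - c) : ℝ) : ℂ)
          * conj ((Real.smoothTransition (C x - c) : ℝ) : ℂ) ≠ 0
    rw [heq]
    exact Complex.ofReal_ne_zero.2 hpos.ne'

/-! ### Densities of localized solutions -/

theorem locFT_eq_dualFT {T : ℝ} {u : Distr (slab T)} {v : SpaceTime → ℂ}
    (huv : ∀ θ : TestFunctions (slab T), u.toLin θ = ∫ p, v p * θ.1 p) (φ : TimeTest T) (k : ℤ)
    (σ : ℝ) : locFT u φ k σ = (2 * Real.pi : ℂ) * dualFT (cut φ (fun _ => 1) v) (k, σ) := by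
  rw [locFT, huv]
  exact integral_mul_tensor_modulate φ _ v k σ _ fun x => (mul_one _).symm

theorem enorm_two_pi : ‖(2 * Real.pi : ℂ)‖ₑ = ENNReal.ofReal (2 * Real.pi) := by
  have : (2 * Real.pi : ℂ) = ((2 * Real.pi : ℝ) : ℂ) := by push_cast; rfl
  rw [this, ← ofReal_norm, Complex.norm_real, Real.norm_of_nonneg Real.two_pi_pos.le]

theorem enorm_dualFT_le_locFT {T : ℝ} {u : Distr (slab T)} {v : SpaceTime → ℂ}
    (huv : ∀ θ : TestFunctions (slab T), u.toLin θ = ∫ p, v p * θ.1 p) (φ : TimeTest T) (k : ℤ)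
    (σ : ℝ) : ‖dualFT (cut φ (fun _ => 1) v) (k, σ)‖ₑ ≤ ‖locFT u φ k σ‖ₑ := by
  rw [locFT_eq_dualFT huv, enorm_mul, enorm_two_pi]
  refine le_mul_of_one_le_left' (ENNReal.one_le_ofReal.2 ?_)
  linarith [Real.pi_gt_three]

theorem measurable_locFT {T : ℝ} {u : Distr (slab T)} {v : SpaceTime → ℂ} (hv : MemLp v 2)
    (huv : ∀ θ : TestFunctions (slab T), u.toLin θ = ∫ p, v p * θ.1 p) (φ : TimeTest T) (k : ℤ) :
    Measurable (locFT u φ k) := by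
  have : locFT u φ k = fun σ => (2 * Real.pi : ℂ) * dualFT (cut φ (fun _ => 1) v) (k, σ) :=
    funext fun σ => locFT_eq_dualFT huv φ k σ
  rw [this]
  exact ((measurable_dualFT (integrable_cut φ contDiff_const hv)).comp
    measurable_prodMk_left).const_mul _

/-- The Fourier modes of the density `|g|²` are correlations of the Fourier transform of `g`. -/
theorem enorm_integral_fourier_mul_density_le {g : SpaceTime → ℂ} (g1 : Integrable g)
    (g2 : MemLp g 2) (m : ℤ) :
    ‖∫ p, fourier m p.2 * (g p * conj (g p))‖ₑ
      ≤ ∑' k : ℤ, ∫⁻ σ, ‖dualFT g (k, σ)‖ₑ * ‖dualFT g (k - m, σ)‖ₑ := by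
  have h1 := integrable_fourier_mul g1 m
  have h2 : MemLp (fun p : SpaceTime => fourier m p.2 * g p) 2 := by
    refine (memLp_congr_norm h1.1 g2.1 (Eventually.of_forall fun p => ?_)).2 g2
    rw [norm_mul, fourier_apply, Circle.norm_coe, one_mul]
  have e := integral_inner_dualFT g1 g2 h1 h2
  simp only [mul_assoc] at e
  rw [← e]
  refine (enorm_integral_le_lintegral_enorm _).trans_eq ?_
  have hm := measurable_dualFT g1
  have hm' := measurable_dualFT h1
  have hmm : Measurable fun p => ‖dualFT (fun p => fourier m p.2 * g p) p * conj (dualFT g p)‖ₑ :=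
    (hm'.mul (Complex.continuous_conj.measurable.comp hm)).enorm
  rw [lintegral_dualMeasure hmm]
  refine tsum_congr fun k => lintegral_congr fun σ => ?_
  rw [enorm_mul, dualFT_fourier_mul, ← ofReal_norm (conj _), RCLike.norm_conj, ofReal_norm,
    mul_comm]

theorem enorm_integral_mul_conj {g : SpaceTime → ℂ} (g2 : MemLp g 2) :
    ‖∫ p, g p * conj (g p)‖ₑ = eLpNorm g 2 volume ^ 2 := by
  have h : ∫ p, g p * conj (g p) = ((∫ p, ‖g p‖ ^ 2 : ℝ) : ℂ) := by
    rw [← integral_complex_ofReal]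
    refine integral_congr_ae (Eventually.of_forall fun p => ?_)
    simp only [Complex.mul_conj, Complex.normSq_eq_norm_sq]
  have hnn : 0 ≤ ∫ p, ‖g p‖ ^ 2 := integral_nonneg fun p => by positivity
  rw [h, ← ofReal_norm, Complex.norm_real, Real.norm_of_nonneg hnn,
    ofReal_integral_eq_lintegral_ofReal (g2.integrable_norm_pow (by norm_num))
    (Eventually.of_forall fun p => by positivity), eLpNorm_two_sq]
  refine lintegral_congr fun p => ?_
  rw [ENNReal.ofReal_pow (norm_nonneg _), ofReal_norm]

theorem integrable_mul_conj {g : SpaceTime → ℂ} (g2 : MemLp g 2) :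
    Integrable fun p => g p * conj (g p) :=
  g2.integrable_mul g2.star

theorem integral_norm_mul_conj {g : SpaceTime → ℂ} (g2 : MemLp g 2) :
    ∫ p, ‖g p * conj (g p)‖ = (eLpNorm g 2 volume ^ 2).toReal := by
  rw [integral_norm_eq_lintegral_enorm (integrable_mul_conj g2).1, eLpNorm_two_sq]
  congr 1
  refine lintegral_congr fun p => ?_
  rw [enorm_mul, ← ofReal_norm (conj _), RCLike.norm_conj, ofReal_norm, sq]

theorem eLpNorm_cut_le_xTNorm (j : ℕ) {T b : ℝ} (hb0 : 0 ≤ b) (hb1 : b ≤ 1) {u : Distr (slab T)}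
    {v : SpaceTime → ℂ} (hv : MemLp v 2)
    (huv : ∀ θ : TestFunctions (slab T), u.toLin θ = ∫ p, v p * θ.1 p) (φ : TimeTest T) :
    eLpNorm (cut φ (fun _ => 1) v) 2 volume
      ≤ ENNReal.ofReal (2 * Real.pi) ^ (1 / 2 : ℝ) * (2 * φ.hatNorm + 1) * xTNorm j T 0 b u := by
  have c1 := integrable_cut φ (ψ := fun _ => 1) contDiff_const hv
  have c2 := memLp_cut φ (ψ := fun _ => 1) contDiff_const hv
  have hsq : ∀ z : ℝ≥0∞, (z ^ 2) ^ (1 / 2 : ℝ) = z := fun z => by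
    rw [← ENNReal.rpow_natCast, ← ENNReal.rpow_mul]; simp
  rw [← hsq (eLpNorm _ 2 volume), eLpNorm_two_sq, ← tsum_lintegral_fourierST c1 c2, mul_assoc]
  have hle : ∑' k : ℤ, ∫⁻ σ, ‖fourierST (cut φ (fun _ => 1) v) σ k‖ₑ ^ 2
      ≤ ∑' k : ℤ, ∫⁻ σ, ‖locFT u φ k σ‖ₑ ^ 2 :=
    ENNReal.tsum_le_tsum fun k => lintegral_mono fun σ =>
      pow_le_pow_left' (enorm_dualFT_le_locFT huv φ k σ) 2
  refine (ENNReal.rpow_le_rpow hle (by norm_num)).trans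
    ((tsum_lintegral_le_weightedNorm j hb0 _).trans (mul_le_mul_right ?_ _))
  exact weightedNorm_locFT_le j 0 (by rwa [abs_of_nonneg hb0]) u φ

/-- Off the zero mode, the density `|φ u|²` is small when `u` and the right-hand side `f` are small
in the weak norm. -/
theorem enorm_integral_fourier_mul_cut_le {j : ℕ} {T b : ℝ} (hb0 : 0 ≤ b) (hb1 : b ≤ 1)
    {u f : Distr (slab T)} (heq : SolvesLinear j u f) {v : SpaceTime → ℂ} (hv : MemLp v 2)
    (huv : ∀ θ : TestFunctions (slab T), u.toLin θ = ∫ p, v p * θ.1 p) (φ : TimeTest T)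
    {m : ℤ} (hm : m ≠ 0) :
    ‖∫ p, fourier m p.2 * (cut φ (fun _ => 1) v p * conj (cut φ (fun _ => 1) v p))‖ₑ
      ≤ 2 * ENNReal.ofReal (2 ^ (j + 1) * (2 * Real.pi)) *
        ((2 * φ.hatNorm + 1) * xTNorm j T 0 b u *
          ((2 * φ.hatNorm + 1) * xTNorm j T (-2 * j + 2 * j * b) (-b) f
            + (2 * φ.deriv.hatNorm + 1) * xTNorm j T (-2 * j + 2 * j * b) (-b) u)) := by
  have c1 := integrable_cut φ (ψ := fun _ => 1) contDiff_const hv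
  have c2 := memLp_cut φ (ψ := fun _ => 1) contDiff_const hv
  have hb : |b| ≤ 1 := by rwa [abs_of_nonneg hb0]
  have hb' : |-b| ≤ 1 := by rwa [abs_neg]
  refine (enorm_integral_fourier_mul_density_le c1 c2 m).trans ?_
  refine (ENNReal.tsum_le_tsum fun k => lintegral_mono fun σ => mul_le_mul'
    (enorm_dualFT_le_locFT huv φ k σ) (enorm_dualFT_le_locFT huv φ (k - m) σ)).trans ?_
  refine (tsum_lintegral_locFT_shift_le hb0 hb1 hm heq φ (measurable_locFT hv huv φ)
    (measurable_locFT hv huv φ.deriv)).trans ?_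
  exact mul_le_mul_right (mul_le_mul' (weightedNorm_locFT_le j 0 hb u φ)
    (add_le_add (weightedNorm_locFT_le j _ hb' f φ) (weightedNorm_locFT_le j _ hb' u φ.deriv))) _

theorem TimeTest.exists_norm_le {T : ℝ} (φ : TimeTest T) :
    ∃ B : ℝ, 0 ≤ B ∧ ∀ t, ‖φ.toFun t‖ ≤ B := by
  obtain ⟨B, hB⟩ := φ.hasCompactSupport.exists_bound_of_continuous φ.continuous
  exact ⟨B, (norm_nonneg _).trans (hB 0), hB⟩

/-- On `(0, T) × ω`, the function representing `u` agrees with any other function representing `u`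
there: by Plancherel, products with a smooth cutoff are determined by their Fourier transforms. -/
theorem eLpNorm_cut_le_l2Norm {T : ℝ} {u : Distr (slab T)} {v : SpaceTime → ℂ} (hv : MemLp v 2)
    (huv : ∀ θ : TestFunctions (slab T), u.toLin θ = ∫ p, v p * θ.1 p) (φ : TimeTest T)
    {ω : Set Torus} (hω : IsOpen ω) {ψ : Torus → ℂ}
    (hψ : ContDiff ℝ (⊤ : ℕ∞) fun x : ℝ => ψ x) (hψω : tsupport ψ ⊆ ω) (hψ1 : ∀ x, ‖ψ x‖ ≤ 1)
    {B : ℝ} (hB0 : 0 ≤ B) (hB : ∀ t, ‖φ.toFun t‖ ≤ B) :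
    eLpNorm (cut φ ψ v) 2 volume ≤ (ENNReal.ofReal B + 1) * u.l2Norm (Ioo 0 T) ω := by
  refine ENNReal.le_mul_of_forall_lt (Or.inl (by simp)) (Or.inl (by simp)) ?_
  intro a ha c hc
  simp only [Distr.l2Norm, iInf_lt_iff] at hc
  obtain ⟨v', hv', huv', hlt⟩ := hc
  set V : Set SpaceTime := Ioo 0 T ×ˢ ω with hV
  have hVm : MeasurableSet V := measurableSet_Ioo.prod hω.measurableSet
  have hw : MemLp (V.indicator v') 2 :=
    (memLp_indicator_iff_restrict hVm).2 ⟨hv', hlt.trans_le le_top⟩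
  have hFT : dualFT (cut φ ψ v) = dualFT (cut φ ψ (V.indicator v')) := by
    funext ⟨k, σ⟩
    have hχ : ContDiff ℝ (⊤ : ℕ∞) fun x : ℝ => (fourier (-k) (x : Torus) : ℂ) * ψ x :=
      (contDiff_fourier (-k)).mul hψ
    let θ := (φ.modulate σ).tensor (fun x => (fourier (-k) x : ℂ) * ψ x) hχ
    have hsupp : tsupport θ.1 ⊆ V := by
      have h1 : tsupport θ.1 ⊆ tsupport φ.toFun ×ˢ tsupport ψ := by
        refine closure_minimal (fun p hp => ⟨?_, ?_⟩)
          (isClosed_closure.prod isClosed_closure)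
        · exact subset_tsupport _ fun h0 => hp (by simp [θ, TimeTest.tensor, TimeTest.modulate, h0])
        · exact subset_tsupport _ fun h0 => hp (by simp [θ, TimeTest.tensor, h0])
      exact h1.trans (prod_mono φ.tsupport_subset hψω)
    have e1 := integral_mul_tensor_modulate φ ψ v k σ hχ fun x => rfl
    have e2 := integral_mul_tensor_modulate φ ψ (V.indicator v') k σ hχ fun x => rfl
    have e3 : ∫ p, v p * θ.1 p = ∫ p, V.indicator v' p * θ.1 p := by
      rw [← huv θ, huv' θ hsupp, ← integral_indicator hVm]
      refine integral_congr_ae (Eventually.of_forall fun p => ?_)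
      by_cases hp : p ∈ V <;> simp [hp]
    have hpi : (2 * Real.pi : ℂ) ≠ 0 := by exact_mod_cast Real.two_pi_pos.ne'
    exact mul_left_cancel₀ hpi (e1.symm.trans (e3.trans e2))
  rw [← eLpNorm_dualFT (integrable_cut φ hψ hv) (memLp_cut φ hψ hv), hFT,
    eLpNorm_dualFT (integrable_cut φ hψ hw) (memLp_cut φ hψ hw)]
  have hle : ∀ p, ‖cut φ ψ (V.indicator v') p‖ ≤ B * ‖V.indicator v' p‖ := fun p => by
    rw [cut, norm_mul, norm_mul]
    refine mul_le_mul_of_nonneg_right ?_ (norm_nonneg _)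
    exact (mul_le_mul (hB _) (hψ1 _) (norm_nonneg _) hB0).trans_eq (mul_one B)
  refine (eLpNorm_le_mul_eLpNorm_of_ae_le_mul (Eventually.of_forall hle) 2).trans ?_
  rw [eLpNorm_indicator_eq_eLpNorm_restrict hVm]
  exact mul_le_mul' (le_self_add.trans ha.le) hlt.le

theorem l2Norm_le_eLpNorm_cut {T : ℝ} {u : Distr (slab T)} {v : SpaceTime → ℂ} (hv : MemLp v 2)
    (huv : ∀ θ : TestFunctions (slab T), u.toLin θ = ∫ p, v p * θ.1 p) (φ : TimeTest T)
    {t₀ t₁ : ℝ} (hφ : ∀ t ∈ Ioo t₀ t₁, φ.toFun t = 1) :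
    u.l2Norm (Ioo t₀ t₁) univ ≤ eLpNorm (cut φ (fun _ => 1) v) 2 volume := by
  have hVm : MeasurableSet (Ioo t₀ t₁ ×ˢ (univ : Set Torus)) :=
    measurableSet_Ioo.prod MeasurableSet.univ
  have h1 : u.l2Norm (Ioo t₀ t₁) univ
      ≤ eLpNorm v 2 (volume.restrict (Ioo t₀ t₁ ×ˢ (univ : Set Torus))) := by
    refine iInf_le_of_le v (iInf_le_of_le hv.1.restrict (iInf_le_of_le (fun θ hθ => ?_) le_rfl))
    rw [huv θ]
    refine (setIntegral_eq_integral_of_forall_compl_eq_zero fun p hp => ?_).symm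
    rw [image_eq_zero_of_notMem_tsupport fun h => hp (hθ h), mul_zero]
  refine h1.trans ?_
  have h2 : eLpNorm v 2 (volume.restrict (Ioo t₀ t₁ ×ˢ (univ : Set Torus)))
      = eLpNorm (cut φ (fun _ => 1) v) 2 (volume.restrict (Ioo t₀ t₁ ×ˢ (univ : Set Torus))) := by
    refine eLpNorm_congr_ae ?_
    filter_upwards [ae_restrict_mem hVm] with p hp
    simp [cut, hφ p.1 hp.1]
  rw [h2]
  exact eLpNorm_restrict_le _ _ _ _

/-- A time cutoff equal to `1` on a compact subinterval of `(0, T)`. -/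
theorem TimeTest.exists_eq_one {T t₀ t₁ : ℝ} (h0 : 0 < t₀) (h1 : t₁ < T) :
    ∃ φ : TimeTest T, ∀ t ∈ Ioo t₀ t₁, φ.toFun t = 1 := by
  obtain h | h := le_or_gt t₁ t₀
  · refine ⟨⟨fun _ => 0, contDiff_const, HasCompactSupport.zero, by simp [tsupport]⟩, ?_⟩
    simp [Ioo_eq_empty (not_lt.2 h)]
  · obtain ⟨r, hr1, hr2⟩ : ∃ r, (t₁ - t₀) / 2 < r ∧ r < min ((t₀ + t₁) / 2) (T - (t₀ + t₁) / 2) :=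
      exists_between (lt_min (by linarith) (by linarith))
    obtain ⟨hr3, hr4⟩ := lt_min_iff.1 hr2
    let χ : ContDiffBump ((t₀ + t₁) / 2) := ⟨(t₁ - t₀) / 2, r, by linarith, hr1⟩
    have hts : tsupport (fun t => (χ t : ℂ)) ⊆ tsupport χ :=
      closure_mono fun t ht h0 => ht (by simp [h0])
    refine ⟨⟨fun t => (χ t : ℂ), Complex.ofRealCLM.contDiff.comp χ.contDiff,
      χ.hasCompactSupport.comp_left (g := Complex.ofReal) rfl, hts.trans ?_⟩, fun t ht => ?_⟩
    · rw [χ.tsupport_eq, Real.closedBall_eq_Icc]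
      intro t ht
      have h2 : χ.rOut = r := rfl
      rw [h2] at ht
      exact ⟨by linarith [ht.1], by linarith [ht.2]⟩
    · have : χ t = 1 := χ.one_of_mem_closedBall (by
        rw [Real.closedBall_eq_Icc]
        have h2 : χ.rIn = (t₁ - t₀) / 2 := rfl
        rw [h2]
        exact ⟨by linarith [ht.1], by linarith [ht.2]⟩)
      simp [this]

end Kdv

end

theorem proposition4p5 (j : ℕ) (hj : 1 ≤ j) (T b b' : ℝ) (hT : 0 < T)
    (hb'0 : 0 ≤ b') (hb'b : b' ≤ b) (hb1 : b ≤ 1) (hb0 : 0 < b)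
    (u f : ℕ → Kdv.Distr (Kdv.slab T))
    (hu : ∀ n, Kdv.MemXT j T 0 b (u n))
    (hf : ∀ n, Kdv.MemXT j T (-2 * j + 2 * j * b) (-b) (f n))
    (heq : ∀ n, Kdv.SolvesLinear j (u n) (f n))
    (hbdd : ∃ C : ℝ≥0, ∀ n, Kdv.xTNorm j T 0 b (u n) ≤ C)
    (hlim : Tendsto (fun n =>
        Kdv.xTNorm j T (-2 * j + 2 * j * b) (-b) (u n)
          + Kdv.xTNorm j T (-2 * j + 2 * j * b) (-b) (f n)
          + Kdv.xTNorm j T (-1 + 2 * j * b') (-b') (u n)) atTop (𝓝 0))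
    (ω : Set Kdv.Torus) (hωo : IsOpen ω) (hωn : ω.Nonempty)
    (hω : Tendsto (fun n => (u n).l2Norm (Ioo 0 T) ω) atTop (𝓝 0)) :
    ∀ t₀ t₁ : ℝ, 0 < t₀ → t₁ < T →
      (∀ n, (u n).l2Norm (Ioo t₀ t₁) univ < ∞) ∧
        Tendsto (fun n => (u n).l2Norm (Ioo t₀ t₁) univ) atTop (𝓝 0) := by
  open Kdv ComplexConjugate in
  intro t₀ t₁ ht₀ ht₁
  obtain ⟨φ, hφ⟩ := TimeTest.exists_eq_one ht₀ ht₁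
  choose v hv huv using fun n => exists_memLp_of_memXT hb0.le (hu n)
  let g : ℕ → SpaceTime → ℂ := fun n => cut φ (fun _ => 1) (v n)
  have g2 : ∀ n, MemLp (g n) 2 := fun n => memLp_cut φ contDiff_const (hv n)
  have hle : ∀ n, (u n).l2Norm (Ioo t₀ t₁) univ ≤ eLpNorm (g n) 2 volume := fun n =>
    l2Norm_le_eLpNorm_cut (hv n) (huv n) φ hφ
  refine ⟨fun n => (hle n).trans_lt (g2 n).2, ?_⟩
  refine tendsto_of_tendsto_of_tendsto_of_le_of_le tendsto_const_nhds ?_ (fun n => zero_le) hle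
  have hA : ∀ φ : TimeTest T, 2 * φ.hatNorm + 1 ≠ ∞ := fun φ =>
    ENNReal.add_ne_top.2 ⟨ENNReal.mul_ne_top (by simp) φ.hatNorm_ne_top, by simp⟩
  -- The localized masses `‖φ uₙ‖²` are bounded.
  obtain ⟨C, hC⟩ := hbdd
  obtain ⟨M, hMtop, hM⟩ : ∃ M : ℝ≥0∞, M ≠ ∞ ∧ ∀ n, eLpNorm (g n) 2 volume ≤ M :=
    ⟨ENNReal.ofReal (2 * Real.pi) ^ (1 / 2 : ℝ) * (2 * φ.hatNorm + 1) * C,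
      ENNReal.mul_ne_top (ENNReal.mul_ne_top
        (ENNReal.rpow_ne_top_of_nonneg (by norm_num) ENNReal.ofReal_ne_top) (hA φ))
        ENNReal.coe_ne_top,
      fun n => (eLpNorm_cut_le_xTNorm j hb0.le hb1 (hv n) (huv n) φ).trans
        (mul_le_mul_right (hC n) _)⟩
  let L : ℕ → C(Torus, ℂ) →ₗ[ℂ] ℂ := fun n =>
    densityForm (fun p => g n p * conj (g n p)) (integrable_mul_conj (g2 n))
  have hLb : ∀ n h, ‖L n h‖ ≤ (M ^ 2).toReal * ‖h‖ := fun n h => by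
    refine (norm_densityForm_le _ h).trans (mul_le_mul_of_nonneg_right ?_ (norm_nonneg _))
    rw [integral_norm_mul_conj (g2 n)]
    exact ENNReal.toReal_mono (ENNReal.pow_ne_top hMtop) (pow_le_pow_left' (hM n) 2)
  have hlimu : Tendsto (fun n => xTNorm j T (-2 * j + 2 * j * b) (-b) (u n)) atTop (𝓝 0) :=
    tendsto_of_tendsto_of_tendsto_of_le_of_le tendsto_const_nhds hlim (fun n => zero_le)
      fun n => le_self_add.trans le_self_add
  have hlimf : Tendsto (fun n => xTNorm j T (-2 * j + 2 * j * b) (-b) (f n)) atTop (𝓝 0) :=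
    tendsto_of_tendsto_of_tendsto_of_le_of_le tendsto_const_nhds hlim (fun n => zero_le)
      fun n => le_add_self.trans le_self_add
  have hL0 : ∀ m : ℤ, m ≠ 0 → Tendsto (fun n => L n (fourier m)) atTop (𝓝 0) := fun m hm => by
    rw [tendsto_zero_iff_enorm_tendsto_zero]
    have hb := fun n => enorm_integral_fourier_mul_cut_le hb0.le hb1 (heq n) (hv n) (huv n) φ hm
    have hlim0 : Tendsto (fun n => 2 * ENNReal.ofReal (2 ^ (j + 1) * (2 * Real.pi)) *
        ((2 * φ.hatNorm + 1) * C *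
          ((2 * φ.hatNorm + 1) * xTNorm j T (-2 * j + 2 * j * b) (-b) (f n)
            + (2 * φ.deriv.hatNorm + 1) * xTNorm j T (-2 * j + 2 * j * b) (-b) (u n))))
        atTop (𝓝 0) := by
      have h1 := (ENNReal.Tendsto.const_mul hlimf (Or.inr (hA φ))).add
        (ENNReal.Tendsto.const_mul hlimu (Or.inr (hA φ.deriv)))
      have h2 := ENNReal.Tendsto.const_mul (a := (2 * φ.hatNorm + 1) * C) h1
        (Or.inr (ENNReal.mul_ne_top (hA φ) ENNReal.coe_ne_top))
      have h3 := ENNReal.Tendsto.const_mul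
        (a := 2 * ENNReal.ofReal (2 ^ (j + 1) * (2 * Real.pi))) h2
        (Or.inr (ENNReal.mul_ne_top (by simp) ENNReal.ofReal_ne_top))
      simpa only [mul_zero, add_zero] using h3
    refine tendsto_of_tendsto_of_tendsto_of_le_of_le tendsto_const_nhds hlim0 (fun n => zero_le)
      fun n => (hb n).trans ?_
    exact mul_le_mul_right (mul_le_mul_left (mul_le_mul_right (hC n) _) _) _
  obtain ⟨ψ, hψ, hψω, hψ1, hψ0⟩ := exists_smooth_tsupport_subset hωo hωn
  obtain ⟨B, hB0, hB⟩ := φ.exists_norm_le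
  have hLψ : Tendsto (fun n => L n (ψ * star ψ)) atTop (𝓝 0) := by
    rw [tendsto_zero_iff_enorm_tendsto_zero]
    have hlim1 : Tendsto (fun n => ((ENNReal.ofReal B + 1) * (u n).l2Norm (Ioo 0 T) ω) ^ 2)
        atTop (𝓝 0) := by
      have h1 := ENNReal.Tendsto.const_mul (a := ENNReal.ofReal B + 1) hω (Or.inr (by simp))
      simpa using ENNReal.Tendsto.pow (n := 2) h1
    refine tendsto_of_tendsto_of_tendsto_of_le_of_le tendsto_const_nhds hlim1 (fun n => zero_le)
      fun n => ?_
    have e : L n (ψ * star ψ) = ∫ p, cut φ ψ (v n) p * conj (cut φ ψ (v n) p) := by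
      refine integral_congr_ae (Eventually.of_forall fun p => ?_)
      simp only [ContinuousMap.mul_apply, ContinuousMap.star_apply, RCLike.star_def, g, cut,
        map_mul, mul_one]
      ring
    simp only [e]
    rw [enorm_integral_mul_conj (memLp_cut φ hψ (hv n))]
    exact pow_le_pow_left' (eLpNorm_cut_le_l2Norm (hv n) (huv n) φ hωo hψ hψω hψ1 hB0 hB) 2
  -- Comparing the mean of `|ψ|²` with its vanishing integral against `|φ uₙ|²` kills the mass.
  have hL1 : Tendsto (fun n => L n 1) atTop (𝓝 0) := by
    have h1 := tendsto_sub_integral_mul hLb hL0 (ψ * star ψ)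
    have h2 := ((hLψ.const_mul ((2 * Real.pi : ℝ) : ℂ)).sub h1).const_mul
      (∫ x, (ψ * star ψ) x)⁻¹
    have h3 : (∫ x, (ψ * star ψ) x) ≠ 0 := hψ0
    simpa only [sub_sub_cancel, inv_mul_cancel_left₀ h3, mul_zero, sub_zero] using h2
  rw [tendsto_zero_iff_enorm_tendsto_zero] at hL1
  have hsq : ∀ n, eLpNorm (g n) 2 volume = ‖L n 1‖ₑ ^ (1 / 2 : ℝ) := fun n => by
    have e : L n 1 = ∫ p, g n p * conj (g n p) := by
      refine integral_congr_ae (Eventually.of_forall fun p => ?_)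
      simp
    rw [e, enorm_integral_mul_conj (g2 n), ← ENNReal.rpow_natCast, ← ENNReal.rpow_mul]
    simp
  simp only [hsq]
  have h := (ENNReal.continuous_rpow_const (y := (1 / 2 : ℝ))).tendsto 0
  rw [ENNReal.zero_rpow_of_pos (by norm_num)] at h
  exact h.comp hL1
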